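/- **Setting.** Let $\mathscr C$ be the set of finite continued fraction expansions: $[0]$, $[0,0]$, and $[0,0,c_1,\dots,c_k]$ with $k\ge1$, $c_1,\dots,c_{k-1}\ge 1$ and $c_k\ge -1$ integers. For $\mathbf c=[0,c_0,\dots,c_k]$ write $[\mathbf c,m]=[0,c_0,\dots,c_k,m]$. Let $\varphi:\mathscr C\to\mathbb Q\cup\{\infty\}$ be the evaluation map: $\varphi([0])=\infty$, $\varphi([0,0,-1])=-1$; otherwise, a last digit $c_k=-1$ with $k\ge 2$ is removed and $c_{k-1}$ is replaced by $c_{k-1}-1$, a last digit $c_k=0$ with $k\ge1$ is removed together with $c_{k-1}$, and in all other cases $\varphi(\mathbf c)$ is the usual value $c_0+1/(c_1+1/(\cdots+1/c_k))$. For $E,V\in\mathbb R$ and $\varphi(\mathbf c)=p/q$ in lowest terms with $q\ge 1$, put $\omega(n)=\lfloor (n+1)\tfrac pq\rfloor-\lfloor n\tfrac pq\rfloor$, $A(n)=\begin{pmatrix}E-V\omega(n)&-1\\1&0\end{pmatrix}$ and $t_{\mathbf c}(E,V)=\operatorname{tr}\big(A(q-1)\cdots A(1)A(0)\big)$; if $\varphi(\mathbf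 c)=\infty$, put $t_{\mathbf c}=\operatorname{tr}\begin{pmatrix}1&-V\\0&1\end{pmatrix}=2$. Let $\sigma_{\mathbf c}(V)=\{E\in\mathbb R: |t_{\mathbf c}(E,V)|\le 2\}$. The *spectral bands* of $\sigma_{\mathbf c}(V)$ are its connected components. For closed intervals $I=[a,b]$, $J=[c,d]$ write $I\subseteq_{\rm str}J$ if $c<a$ and $b<d$ (where $J=\mathbb R$ is allowed, with $c=-\infty$, $d=\infty$), $I\prec J$ if $a<c$ and $b<d$, and $I\prec_{\rm str}J$ if $b<c$. A band $I$ of $\sigma_{\mathbf c}(V)$ is of *backward type $A$* (resp. *weak backward type $A$*) if $I\subseteq_{\rm str}J$ (resp. $I\subseteq J$) for some band $J$ of $\sigma_{[\mathbf c,0]}(V)$, and of *(weak) backward type $B$* if the same holds with $[\mathbf c,-1]$ in place of $[\mathbf c,0]$. For $m\ge1$, a band $I_{\mathbf c}$ of $\sigma_{\mathbf c}(V)$ is of *$m$-forward type $A$*, with $M=m-1$ (resp. *$m$-forward type $B$*, with $M=m$), if there are bands $I^i_{[\mathbf c,m]}$ $(1\le i\le M)$ of $\sigma_{[\mathbf c,m]}(V)$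 and bands $I^j_{[\mathbf c,m,n]}$ $(1\le j\le M+1,\ n\ge1)$ of $\sigma_{[\mathbf c,m,n]}(V)$ such that - (A) $I^i_{[\mathbf c,m]}\subseteq_{\rm str}I_{\mathbf c}$, and $I^i_{[\mathbf c,m]}$ is not of weak backward type $B$, for all $i$; - (B1) $I^j_{[\mathbf c,m,n]}\subseteq_{\rm str}I^j_{[\mathbf c,m,n-1]}$ for all $j$ and $n\ge1$, where $I^j_{[\mathbf c,m,0]}:=I_{\mathbf c}$; - (B2) $I^j_{[\mathbf c,m,n]}$ is not of weak backward type $A$, for all $j$ and $n\ge1$; - (I) $I^1_{[\mathbf c,m,n]}\prec I^1_{[\mathbf c,m]}\prec I^2_{[\mathbf c,m,n]}\prec\cdots\prec I^M_{[\mathbf c,m]}\prec I^{M+1}_{[\mathbf c,m,n]}$ for all $n\ge1$. A band is of *type $A$* (resp. *type $B$*) if it is of backward type $A$ (resp. $B$) and of $m$-forward type $A$ (resp. $B$) for all $m\ge1$. **Theorem.** Let $\mathbf c\in\mathscr C$ be such that $[\mathbf c,m]\in\mathscr C$ for all integers $m\ge1$, and let $\varphi(\mathbf c)=p/q$ in lowest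 terms. 1. For every $V>4$, every spectral band of $\sigma_{\mathbf c}(V)$ is either of type $A$ or of type $B$, and not both. 2. The type does not depend on $V>4$: for all $V>4$ the set $\sigma_{\mathbf c}(V)$ has exactly $q$ spectral bands $I_1(V)\prec_{\rm str}\cdots\prec_{\rm str}I_q(V)$, and for each $i$ the type of $I_i(V)$ is the same for all $V>4$. 3. Let $V>4$, let $I_{\mathbf c}$ be a spectral band of $\sigma_{\mathbf c}(V)$, and let $m\ge1$; put $M=m-1$ if $I_{\mathbf c}$ is of type $A$ and $M=m$ if it is of type $B$. Then the bands $I^i_{[\mathbf c,m]}$ $(1\le i\le M)$ and $I^j_{[\mathbf c,m,n]}$ $(1\le j\le M+1$, $n\ge1)$ in the definition of $m$-forward type are uniquely determined. Moreover, the $I^i_{[\mathbf c,m]}$ are the only bands of $\sigma_{[\mathbf c,m]}(V)$ contained in $I_{\mathbf c}$; for each $n\ge 1$, every band $L$ of $\sigma_{[\mathbf c,m,n]}(V)$ that is not of weak backward type $A$ and satisfies $L\subseteq_{\rm str}I^{j}_{[\mathbf c,m,n-1]}$ for some $j$ is one of the $I^{j'}_{[\mathbf c,m,n]}$; and for all $n\ge1$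 $$I^1_{[\mathbf c,m,n]}\prec_{\rm str} I^1_{[\mathbf c,m]}\prec_{\rm str} I^2_{[\mathbf c,m,n]}\prec_{\rm str}\cdots\prec_{\rm str} I^M_{[\mathbf c,m]}\prec_{\rm str} I^{M+1}_{[\mathbf c,m,n]}.$$ -/

import Mathlib

namespace Sturmian

/-- The space of finite continued fraction expansions: `[0]`, `[0, 0]`, and
`[0, 0, c₁, …, c_k]` with `k ≥ 1`, `c₁, …, c_{k-1} ≥ 1` and `c_k ≥ -1`.
The expansion `[c, m]` is `c ++ [m]`. -/
def FinCF : Set (List ℤ) :=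
  {c | c = [0] ∨ c = [0, 0] ∨
    ∃ (l : List ℤ) (x : ℤ), (∀ d ∈ l, 1 ≤ d) ∧ -1 ≤ x ∧ c = 0 :: 0 :: (l ++ [x])}

/-- The ordinary value `c₀ + 1 / (c₁ + 1 / (⋯ + 1 / c_k))`. -/
def cfValue : List ℤ → ℚ
  | [] => 0
  | [a] => a
  | a :: b :: l => a + 1 / cfValue (b :: l)

/-- The evaluation map on expansions whose digits are listed from the last one to the first one,
`c_k, c_{k-1}, …, c₀, 0`. -/
def evalRev : List ℤ → OnePoint ℚ
  | [] => OnePoint.infty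
  | [_] => OnePoint.infty
  | [c₀, _] => ((c₀ : ℚ) : OnePoint ℚ)
  | [x, y, z] =>
      if x = -1 then ((-1 : ℚ) : OnePoint ℚ)
      else if x = 0 then evalRev [z]
      else ((cfValue [y, x] : ℚ) : OnePoint ℚ)
  | x :: y :: z :: w :: l =>
      if x = -1 then evalRev ((y - 1) :: z :: w :: l)
      else if x = 0 then evalRev (z :: w :: l)
      else ((cfValue ((x :: y :: z :: w :: l).reverse.tail) : ℚ) : OnePoint ℚ)
  termination_by l => l.length

/-- The evaluation map `φ` from finite continued fraction expansions to `ℚ ∪ {∞}`: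
`φ([0]) = ∞`, `φ([0,0,-1]) = -1`, a last digit `-1` is absorbed into the digit before it,
a last digit `0` removes the last two digits, and otherwise `φ` is the ordinary value. -/
def eval (c : List ℤ) : OnePoint ℚ := evalRev c.reverse

/-- The mechanical word of slope `α`, `ω_α(n) = ⌊(n+1)α⌋ - ⌊nα⌋`. -/
def mechWord (α : ℚ) (n : ℤ) : ℤ := ⌊((n : ℚ) + 1) * α⌋ - ⌊(n : ℚ) * α⌋

/-- The one-step transfer matrix of
`E u(n) = u(n-1) + u(n+1) + V ω_α(n) u(n)`. -/
def stepMatrix (α : ℚ) (n : ℤ) (E V : ℝ) : Matrix (Fin 2) (Fin 2) ℝ :=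
  !![E - V * (mechWord α n : ℝ), -1; 1, 0]

/-- The `N`-step transfer matrix `A_α(N-1) ⋯ A_α(1) A_α(0)`. -/
def transferProd (α : ℚ) (E V : ℝ) : ℕ → Matrix (Fin 2) (Fin 2) ℝ
  | 0 => 1
  | N + 1 => stepMatrix α (N : ℤ) E V * transferProd α E V N

/-- The denominator of a point of `ℚ ∪ {∞}` in lowest terms, with `∞ = 1 / 0`. -/
def den : OnePoint ℚ → ℕ
  | none => 0
  | some r => r.den

/-- The transfer matrix over one period: the `q`-step transfer matrix for the slope `p / q`,
and the matrix of the expansion `[0]` for the slope `∞`. -/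
def transferMatrix (x : OnePoint ℚ) (E V : ℝ) : Matrix (Fin 2) (Fin 2) ℝ :=
  match x with
  | none => !![1, -V; 0, 1]
  | some r => transferProd r E V r.den

/-- The discriminant `t_c(E, V)`. -/
def discr (c : List ℤ) (E V : ℝ) : ℝ := (transferMatrix (eval c) E V).trace

/-- The periodic spectrum `σ_c(V) = t_c(·, V)⁻¹([-2, 2])`. -/
def spec (c : List ℤ) (V : ℝ) : Set ℝ := {E | discr c E V ∈ Set.Icc (-2 : ℝ) 2}

/-- The spectral bands of `σ_c(V)` (for `V ≠ 0`): its connected components. -/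
def IsBand (c : List ℤ) (V : ℝ) (I : Set ℝ) : Prop :=
  ∃ E ∈ spec c V, I = connectedComponentIn (spec c V) E

/-- Strict inclusion of closed intervals: for `I = [a, b]` and `J = [c, d]` this says
`c < a` and `b < d`; the line `J = ℝ` is allowed, with `c = -∞` and `d = ∞`. -/
def StrictIncl (I J : Set ℝ) : Prop := I ⊆ interior J

/-- `I` is to the left of `J`: for `I = [a, b]` and `J = [c, d]` this says `a < c` and `b < d`. -/
def LeftOf (I J : Set ℝ) : Prop := sInf I < sInf J ∧ sSup I < sSup J

/-- `I` is strictly to the left of `J`: for `I = [a, b]` and `J = [c, d]` this says `b < c`. -/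
def StrictLeftOf (I J : Set ℝ) : Prop := ∀ x ∈ I, ∀ y ∈ J, x < y

/-- The two types of spectral bands. -/
inductive BandType
  | A
  | B

/-- The digit that is appended in the definition of the backward types:
`0` for type `A` and `-1` for type `B`. -/
def BandType.digit : BandType → ℤ
  | .A => 0
  | .B => -1

/-- The number `M`: `m - 1` for type `A` and `m` for type `B` (used for `m ≥ 1`). -/
def BandType.count : BandType → ℕ → ℕ
  | .A, m => m - 1
  | .B, m => m

/-- The band `I` of `σ_c(V)` is of backward type `T`. -/
def Backward (T : BandType) (c : List ℤ) (V : ℝ) (I : Set ℝ) : Prop :=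
  ∃ J, IsBand (c ++ [T.digit]) V J ∧ StrictIncl I J

/-- The band `I` of `σ_c(V)` is of weak backward type `T`. -/
def WeakBackward (T : BandType) (c : List ℤ) (V : ℝ) (I : Set ℝ) : Prop :=
  ∃ J, IsBand (c ++ [T.digit]) V J ∧ I ⊆ J

/-- The families of sub-bands in the definition of `m`-forward type, for the band `I` of `σ_c(V)`.
`J i` is the band `I_{[c,m]}^{i+1}`, and `K n j` is the band `I_{[c,m,n]}^{j+1}` for `n ≥ 1`,
with `K 0 j = I`. -/
structure IsForwardFamily (c : List ℤ) (V : ℝ) (I : Set ℝ) (m M : ℕ)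
    (J : Fin M → Set ℝ) (K : ℕ → Fin (M + 1) → Set ℝ) : Prop where
  bandA : ∀ i, IsBand (c ++ [(m : ℤ)]) V (J i)
  strictA : ∀ i, StrictIncl (J i) I
  not_weakB : ∀ i, ¬ WeakBackward .B (c ++ [(m : ℤ)]) V (J i)
  zero : ∀ j, K 0 j = I
  bandB : ∀ n : ℕ, 1 ≤ n → ∀ j, IsBand (c ++ [(m : ℤ), (n : ℤ)]) V (K n j)
  strictB : ∀ n : ℕ, 1 ≤ n → ∀ j, StrictIncl (K n j) (K (n - 1) j)
  not_weakA : ∀ n : ℕ, 1 ≤ n → ∀ j, ¬ WeakBackward .A (c ++ [(m : ℤ), (n : ℤ)]) V (K n j)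
  interlace : ∀ n : ℕ, 1 ≤ n → ∀ i : Fin M,
    LeftOf (K n i.castSucc) (J i) ∧ LeftOf (J i) (K n i.succ)

/-- The band `I` of `σ_c(V)` is of `m`-forward type `T`. -/
def Forward (T : BandType) (c : List ℤ) (V : ℝ) (I : Set ℝ) (m : ℕ) : Prop :=
  ∃ J K, IsForwardFamily c V I m (T.count m) J K

/-- The band `I` of `σ_c(V)` is of type `T`: backward type `T`, and `m`-forward type `T`
for all `m ≥ 1`. -/
def HasType (T : BandType) (c : List ℤ) (V : ℝ) (I : Set ℝ) : Prop :=
  Backward T c V I ∧ ∀ m : ℕ, 1 ≤ m → Forward T c V I m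

end Sturmian

/-! Write t for the trace of `c` and t_k for that of `[c, k]`. The transfer matrix of a mediant of
Farey neighbours is the product of theirs (`transferMatrix_mediant`), so Cayley–Hamilton gives
t_{m+1} = t t_m - t_{m-1} (`discr_succ`), and t² + t_m² + t_{m-1}² - t t_m t_{m-1} = 4 + V²
(`discr_invariant`). Three numbers in [-2, 2] make the left side at most 20, so for V > 4 such
traces are never all in [-2, 2] (`not_all_le_two`).

Let I be a band of `c` on which the predecessor t_0 (type A) or t_{-1} (type B) stays in [-2, 2].
Put t = 2 cos θ; the recursion is then solved by sines. At θ = jπ/(M+1) the trace t_m equals the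
predecessor up to sign, hence lies in [-2, 2]. At θ = jπ/(M+2) so does t_{m+1}, while t_m is, up to
a sign alternating in j, the trace one step before the predecessor, which is larger than 2 in
modulus and of constant sign on I. So t_m crosses [-2, 2] between consecutive nodes of the second
kind, at least M times (`TraceSeq.exists_nodes`, `TraceSeq.le_ncard`).

A count makes this exact. Let q, q' be the denominators of `c` and `[c, 0]`, and let α of the q
bands have type A. Then t_m = w has at least α(m-1) + (q-α)m solutions over the bands of `c`, and,
by induction, at least α + q' over those of `[c, m-1]`. The two sets are disjoint, and the sum is mq
+ q', the degree of the monic polynomial t_m. Hence all solutions are found and are simple, every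
band lies over exactly one predecessor, and a band of `c` contains exactly M bands of `[c, m]`
(`core_of_lower`, `Full.append`).

Where |t| = 2 the traces grow linearly in m, so successors are unstable there and inclusions are
strict (`Core.edge`). Bands of `[c, m]` and `[c, m+1]` in I are disjoint by the invariant, hence
ordered as their nodes. The bands for `[c, m, n]` arise by iterating the unique step from a type B
band of `[c, m, n]` to one of `[c, m, n+1]`, and exact counts with sorted order give uniqueness.
Finally, the zeros of t move continuously with V, and the two types are disjoint closed conditions
along their paths. -/

namespace Sturmian

/-! ### Farey neighbours and products of transfer matrices -/

section Farey

/-- The point `p / q` of `ℚ ∪ {∞}`, with `p / 0 = ∞`. -/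
def toPt (p q : ℤ) : OnePoint ℚ :=
  if q = 0 then OnePoint.infty else (((p : ℚ) / q : ℚ) : OnePoint ℚ)

theorem floor_mul_div {q : ℤ} (hq : 0 ≤ q) (p n : ℤ) : ⌊(n : ℚ) * ((p : ℚ) / q)⌋ = n * p / q := by
  have h : (n : ℚ) * ((p : ℚ) / q) = ((n * p : ℤ) : ℚ) / (q : ℚ) := by push_cast; ring
  rw [h]
  lift q to ℕ using hq
  exact Rat.floor_intCast_div_natCast _ _

theorem mechWord_div {q : ℤ} (hq : 0 ≤ q) (p n : ℤ) :
    mechWord ((p : ℚ) / q) n = (n + 1) * p / q - n * p / q := by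
  have := floor_mul_div hq p (n + 1)
  push_cast at this
  rw [mechWord, this, floor_mul_div hq]

theorem ediv_eq_of_bounds {a q k : ℤ} (hq : 0 < q) (h1 : k * q ≤ a) (h2 : a < (k + 1) * q) :
    a / q = k :=
  le_antisymm (Int.lt_add_one_iff.1 (Int.ediv_lt_of_lt_mul hq h2)) (Int.le_ediv_of_mul_le hq h1)

/-- The mechanical word of the mediant is the word of p/q followed by that of p'/q'; this is the
first half. The two bounds on the floor become visible after multiplication by q, where the
determinant condition eliminates p'. -/
theorem mediant_floor_left {p q p' q' n : ℤ} (hq : 1 ≤ q) (hq' : 1 ≤ q')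
    (hdet : p' * q - p * q' = 1) (h0 : 0 ≤ n) (hn : n ≤ q) :
    n * (p + p') / (q + q') = n * p / q := by
  set k := n * p / q with hk
  have h1 : k * q ≤ n * p := Int.ediv_mul_le _ (by lia)
  have h2 : n * p < (k + 1) * q := Int.lt_ediv_add_one_mul_self _ (by lia)
  apply ediv_eq_of_bounds (by lia)
  · have : 0 ≤ q * (n * (p + p') - k * (q + q')) := by
      have : q * (n * (p + p') - k * (q + q')) = (n * p - k * q) * (q + q') + n := by
        linear_combination n * hdet
      rw [this]; nlinarith
    nlinarith
  · have : 0 < q * ((k + 1) * (q + q') - n * (p + p')) := by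
      have : q * ((k + 1) * (q + q') - n * (p + p')) =
          ((k + 1) * q - n * p) * (q + q') - n := by
        linear_combination (-n) * hdet
      rw [this]
      nlinarith
    nlinarith

theorem mediant_floor_right {p q p' q' n : ℤ} (hq : 1 ≤ q) (hq' : 1 ≤ q')
    (hdet : p' * q - p * q' = 1) (h0 : 0 ≤ n) (hn : n ≤ q') :
    (q + n) * (p + p') / (q + q') = p + n * p' / q' := by
  set k := n * p' / q' with hk
  have h1 : k * q' ≤ n * p' := Int.ediv_mul_le _ (by lia)
  have h2 : n * p' < (k + 1) * q' := Int.lt_ediv_add_one_mul_self _ (by lia)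
  apply ediv_eq_of_bounds (by lia)
  · have : 0 ≤ q' * ((q + n) * (p + p') - (p + k) * (q + q')) := by
      have : q' * ((q + n) * (p + p') - (p + k) * (q + q')) =
          (n * p' - k * q') * (q + q') + (q' - n) := by
        linear_combination (q' - n) * hdet
      rw [this]; nlinarith
    nlinarith
  · have : 0 < q' * ((p + k + 1) * (q + q') - (q + n) * (p + p')) := by
      have : q' * ((p + k + 1) * (q + q') - (q + n) * (p + p')) =
          ((k + 1) * q' - n * p') * (q + q') - (q' - n) := by
        linear_combination (n - q') * hdet
      rw [this]
      nlinarith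
    nlinarith

theorem transferProd_congr {α β : ℚ} (E V : ℝ) {N : ℕ}
    (h : ∀ n : ℕ, n < N → mechWord α n = mechWord β n) :
    transferProd α E V N = transferProd β E V N := by
  induction N with
  | zero => rfl
  | succ N ih =>
    simp only [transferProd]
    rw [ih fun n hn => h n (by lia), stepMatrix, stepMatrix, h N (by lia)]

theorem transferProd_add {α β : ℚ} (E V : ℝ) (q N : ℕ)
    (h : ∀ n : ℕ, n < N → mechWord α ((q + n : ℕ) : ℤ) = mechWord β n) :
    transferProd α E V (q + N) = transferProd β E V N * transferProd α E V q := by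
  induction N with
  | zero => simp [transferProd]
  | succ N ih =>
    rw [← add_assoc]
    simp only [transferProd]
    rw [ih fun n hn => h n (by lia), stepMatrix, stepMatrix, h N (by lia), Matrix.mul_assoc]

theorem den_div_of_det {p q p' q' : ℤ} (hq : 1 ≤ q) (hdet : p' * q - p * q' = 1) :
    (((p : ℚ) / q).den : ℤ) = q := by
  have hc : IsCoprime p q := ⟨-q', p', by linarith⟩
  exact Rat.den_div_eq_of_coprime (by lia) (Int.isCoprime_iff_nat_coprime.1 hc)

theorem den_div_of_det' {p q p' q' : ℤ} (hq : 1 ≤ q') (hdet : p' * q - p * q' = 1) :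
    (((p' : ℚ) / q').den : ℤ) = q' :=
  den_div_of_det (p' := -p) (q' := -q) hq (by linarith)

theorem transferMatrix_toPt {p : ℤ} {q : ℕ} (hq : 1 ≤ q) (h : ((p : ℚ) / (q : ℤ)).den = q)
    (E V : ℝ) : transferMatrix (toPt p q) E V = transferProd ((p : ℚ) / (q : ℤ)) E V q := by
  have : (q : ℤ) ≠ 0 := by lia
  rw [toPt, if_neg this]
  change transferProd _ E V (Rat.den _) = _
  rw [h]

theorem transferMatrix_toPt_zero (p : ℤ) (E V : ℝ) :
    transferMatrix (toPt p 0) E V = !![1, -V; 0, 1] := by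
  rw [toPt, if_pos rfl]; rfl

theorem transferMatrix_toPt_one (p : ℤ) (E V : ℝ) :
    transferMatrix (toPt p 1) E V = !![E - V * p, -1; 1, 0] := by
  have := transferMatrix_toPt (p := p) (q := 1) le_rfl (by simp) E V
  simp only [Nat.cast_one] at this
  rw [this]
  simp [transferProd, stepMatrix, mechWord]

/-- The transfer matrix of a mediant of Farey neighbours is the product of the transfer
matrices. -/
theorem transferMatrix_mediant {p q p' q' : ℤ} (hq : 1 ≤ q) (hq' : 0 ≤ q')
    (hdet : p' * q - p * q' = 1) (E V : ℝ) :
    transferMatrix (toPt (p + p') (q + q')) E V =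
      transferMatrix (toPt p' q') E V * transferMatrix (toPt p q) E V := by
  rcases hq'.eq_or_lt with rfl | hq'
  · obtain rfl : q = 1 := by
      have : p' * q = 1 := by linarith
      exact Int.eq_one_of_dvd_one (by lia) ⟨p', by linarith⟩
    obtain rfl : p' = 1 := by linarith
    rw [transferMatrix_toPt_zero, add_zero, transferMatrix_toPt_one, transferMatrix_toPt_one]
    ext i j
    fin_cases i <;> fin_cases j <;> simp
    ring
  · have hq'1 : 1 ≤ q' := hq'
    have d1 := den_div_of_det hq hdet
    have d2 := den_div_of_det' hq'1 hdet
    have d3 : (((p + p' : ℤ) : ℚ) / ((q + q' : ℤ))).den = q + q' :=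
      den_div_of_det (p' := p') (q' := q') (by lia) (by linarith)
    lift q to ℕ using by lia
    lift q' to ℕ using by lia
    have e3 := transferMatrix_toPt (p := p + p') (q := q + q') (by lia) (by exact_mod_cast d3) E V
    have e1 := transferMatrix_toPt (p := p) (q := q) (by lia) (by exact_mod_cast d1) E V
    have e2 := transferMatrix_toPt (p := p') (q := q') (by lia) (by exact_mod_cast d2) E V
    rw [e1, e2]
    rw [Nat.cast_add] at e3
    rw [e3, transferProd_add (β := (p' : ℚ) / (q' : ℤ)),
      transferProd_congr (β := (p : ℚ) / (q : ℤ)) (N := q)]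
    · intro n hn
      rw [mechWord_div (by lia), mechWord_div (by lia), mediant_floor_left hq hq'1 hdet (by lia) (by lia),
        mediant_floor_left hq hq'1 hdet (by lia) (by lia)]
    · intro n hn
      rw [mechWord_div (by lia), mechWord_div (by lia)]
      push_cast
      rw [mediant_floor_right hq hq'1 hdet (by lia) (by lia), add_assoc,
        mediant_floor_right hq hq'1 hdet (by lia) (by lia)]
      ring

theorem det_transferProd (α : ℚ) (E V : ℝ) (N : ℕ) : (transferProd α E V N).det = 1 := by
  induction N with
  | zero => simp [transferProd]
  | succ N ih =>
    rw [transferProd, Matrix.det_mul, ih, stepMatrix, Matrix.det_fin_two]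
    simp

theorem det_transferMatrix (x : OnePoint ℚ) (E V : ℝ) : (transferMatrix x E V).det = 1 := by
  rcases x with _ | r
  · simp [transferMatrix, Matrix.det_fin_two]
  · exact det_transferProd _ _ _ _

/-- The trace of the transfer matrix at `p / q`. -/
def tr (p q : ℤ) (E V : ℝ) : ℝ := (transferMatrix (toPt p q) E V).trace

/-- Cayley–Hamilton: B² = (tr B) B - 1 when det B = 1. -/
theorem trace_mul_sq (A B : Matrix (Fin 2) (Fin 2) ℝ) (hB : B.det = 1) :
    (A * B * B).trace = (A * B).trace * B.trace - A.trace := by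
  rw [Matrix.det_fin_two] at hB
  simp only [Matrix.trace_fin_two, Matrix.mul_apply, Fin.sum_univ_two]
  linear_combination (-(A 0 0) - A 1 1) * hB

theorem tr_two_left {p q p' q' : ℤ} (hq : 1 ≤ q) (hq' : 0 ≤ q')
    (hdet : p' * q - p * q' = 1) (E V : ℝ) :
    tr (2 * p + p') (2 * q + q') E V = tr (p + p') (q + q') E V * tr p q E V - tr p' q' E V := by
  have h1 := transferMatrix_mediant hq hq' hdet E V
  have h2 := transferMatrix_mediant (p := p) (p' := p + p') (q := q) (q' := q + q') hq (by lia)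
    (by linarith) E V
  have e1 : 2 * p + p' = p + (p + p') := by ring
  have e2 : 2 * q + q' = q + (q + q') := by ring
  rw [tr, tr, e1, e2, h2, h1, trace_mul_sq _ _ (det_transferMatrix _ _ _)]
  rfl

theorem tr_two_right {p q p' q' : ℤ} (hq : 1 ≤ q) (hq' : 0 ≤ q')
    (hdet : p' * q - p * q' = 1) (E V : ℝ) :
    tr (p + 2 * p') (q + 2 * q') E V = tr (p + p') (q + q') E V * tr p' q' E V - tr p q E V := by
  have h1 := transferMatrix_mediant hq hq' hdet E V
  have h2 := transferMatrix_mediant (p := p + p') (p' := p') (q := q + q') (q' := q') (by lia) hq'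
    (by linarith) E V
  have e1 : p + 2 * p' = p + p' + p' := by ring
  have e2 : q + 2 * q' = q + q' + q' := by ring
  have h3 : ∀ A B : Matrix (Fin 2) (Fin 2) ℝ, (A * (A * B)).trace = (B * A * A).trace := by
    intro A B
    rw [← Matrix.mul_assoc, Matrix.trace_mul_comm, ← Matrix.mul_assoc]
  rw [tr, tr, e1, e2, h2, h1, h3, Matrix.trace_mul_comm (transferMatrix (toPt p' q') E V),
    trace_mul_sq _ _ (det_transferMatrix _ _ _)]
  rfl

end Farey

end Sturmian

namespace Sturmian

/-! ### Continued fractions, the trace recursion and the invariant -/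

section ContinuedFractions

/-- The matrix `∏ (a, 1; 1, 0)` over the digits of `l`. -/
def cfm (l : List ℤ) : Matrix (Fin 2) (Fin 2) ℤ := (l.map fun a => !![a, 1; 1, 0]).prod

theorem cfm_nil : cfm [] = 1 := rfl

theorem cfm_cons (a : ℤ) (l : List ℤ) : cfm (a :: l) = !![a, 1; 1, 0] * cfm l := by
  simp [cfm]

theorem cfm_append (l : List ℤ) (k : ℤ) : cfm (l ++ [k]) = cfm l * !![k, 1; 1, 0] := by
  simp [cfm]

theorem cfm_append_zero (l : List ℤ) (k : ℤ) (i : Fin 2) :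
    cfm (l ++ [k]) i 0 = k * cfm l i 0 + cfm l i 1 := by
  rw [cfm_append, Matrix.mul_apply, Fin.sum_univ_two]; simp; ring

theorem cfm_append_one (l : List ℤ) (k : ℤ) (i : Fin 2) :
    cfm (l ++ [k]) i 1 = cfm l i 0 := by
  rw [cfm_append, Matrix.mul_apply, Fin.sum_univ_two]; simp

theorem cfm_det (l : List ℤ) :
    cfm l 0 0 * cfm l 1 1 - cfm l 0 1 * cfm l 1 0 = (-1) ^ l.length := by
  rw [← Matrix.det_fin_two]
  induction l with
  | nil => simp [cfm_nil]
  | cons a l ih => rw [cfm_cons, Matrix.det_mul, ih, Matrix.det_fin_two]; simp [pow_succ']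

theorem cfm_pos {l : List ℤ} (hl : ∀ d ∈ l, 1 ≤ d) :
    l = [] ∨ (1 ≤ cfm l 0 1 ∧ cfm l 0 1 ≤ cfm l 0 0 ∧ 0 ≤ cfm l 1 1 ∧ cfm l 1 1 ≤ cfm l 1 0) := by
  induction l using List.reverseRecOn with
  | nil => exact Or.inl rfl
  | append_singleton l k ih =>
    right
    simp only [cfm_append_zero, cfm_append_one]
    have hk : 1 ≤ k := hl k (by simp)
    rcases ih fun d hd => hl d (by simp [hd]) with rfl | ⟨h1, h2, h3, h4⟩
    · simp [cfm_nil, hk]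
    · refine ⟨by lia, by nlinarith, by lia, by nlinarith⟩

theorem one_le_cfm {l : List ℤ} (hl : ∀ d ∈ l, 1 ≤ d) : 1 ≤ cfm l 0 0 := by
  rcases cfm_pos hl with rfl | h
  · simp [cfm_nil]
  · lia

theorem cfm_nonneg {l : List ℤ} (hl : ∀ d ∈ l, 1 ≤ d) : 0 ≤ cfm l 0 1 := by
  rcases cfm_pos hl with rfl | h
  · simp [cfm_nil]
  · lia

theorem cfValue_cons (a : ℤ) {l : List ℤ} (hl : l ≠ []) :
    cfValue (a :: l) = a + 1 / cfValue l := by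
  cases l with
  | nil => exact absurd rfl hl
  | cons b l => rfl

theorem cfValue_append {l : List ℤ} (hl : ∀ d ∈ l, 1 ≤ d) {m : ℤ} (hm : 1 ≤ m) :
    cfValue (l ++ [m]) =
      ((m * cfm l 0 0 + cfm l 0 1 : ℤ) : ℚ) / ((m * cfm l 1 0 + cfm l 1 1 : ℤ) : ℚ) := by
  induction l with
  | nil => simp [cfm_nil, cfValue]
  | cons a l ih =>
    have hl' : ∀ d ∈ l, 1 ≤ d := fun d hd => hl d (by simp [hd])
    rw [List.cons_append, cfValue_cons _ (by simp), ih hl', cfm_cons]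
    have h1 := one_le_cfm hl'
    have h2 := cfm_nonneg hl'
    have hpos : ((m * cfm l 0 0 + cfm l 0 1 : ℤ) : ℚ) ≠ 0 := by
      have : 0 < m * cfm l 0 0 + cfm l 0 1 := by nlinarith
      exact_mod_cast this.ne'
    have e1 : ∀ i, (!![a, 1; 1, 0] * cfm l) 0 i = a * cfm l 0 i + cfm l 1 i := by
      intro i; rw [Matrix.mul_apply, Fin.sum_univ_two]; simp
    have e2 : ∀ i, (!![a, 1; 1, 0] * cfm l) 1 i = cfm l 0 i := by
      intro i; rw [Matrix.mul_apply, Fin.sum_univ_two]; simp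
    simp only [e1, e2]
    rw [one_div_div, eq_div_iff hpos, add_mul, div_mul_cancel₀ _ hpos]
    push_cast
    ring

theorem eval_eq (l : List ℤ) : eval (0 :: 0 :: l) = evalRev (l.reverse ++ [0, 0]) := by
  simp [eval]

theorem exists_cons_cons (l : List ℤ) : ∃ a b t, l.reverse ++ [0, 0] = a :: b :: t := by
  rcases h : l.reverse with _ | ⟨a, _ | ⟨b, t⟩⟩
  · exact ⟨0, 0, [], rfl⟩
  · exact ⟨a, 0, [0], rfl⟩
  · exact ⟨a, b, t ++ [0, 0], rfl⟩

theorem eval_append_zero {l : List ℤ} {k : ℤ} :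
    eval (0 :: 0 :: (l ++ [k] ++ [0])) = eval (0 :: 0 :: l) := by
  rw [eval_eq, eval_eq]
  obtain ⟨a, b, t, h⟩ := exists_cons_cons l
  simp only [List.reverse_append, List.reverse_cons, List.reverse_nil, List.nil_append,
    List.cons_append, h]
  rw [evalRev]; simp

theorem eval_append_neg_one {l : List ℤ} {k : ℤ} :
    eval (0 :: 0 :: (l ++ [k] ++ [-1])) = eval (0 :: 0 :: (l ++ [k - 1])) := by
  rw [eval_eq, eval_eq]
  obtain ⟨a, b, t, h⟩ := exists_cons_cons l
  simp only [List.reverse_append, List.reverse_cons, List.reverse_nil, List.nil_append,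
    List.cons_append, h]
  rw [evalRev]; simp

theorem eval_append_pos {l : List ℤ} (hl : ∀ d ∈ l, 1 ≤ d) {m : ℤ} (hm : 1 ≤ m) :
    eval (0 :: 0 :: (l ++ [m])) =
      toPt (m * cfm l 1 0 + cfm l 1 1) (m * cfm l 0 0 + cfm l 0 1) := by
  have h1 := one_le_cfm hl
  have h2 := cfm_nonneg hl
  have hpos : m * cfm l 0 0 + cfm l 0 1 ≠ 0 := by nlinarith
  have key : eval (0 :: 0 :: (l ++ [m])) = ((cfValue (0 :: (l ++ [m])) : ℚ) : OnePoint ℚ) := by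
    have hm1 : m ≠ -1 := by lia
    have hm0 : m ≠ 0 := by lia
    rw [eval_eq]
    rcases l.eq_nil_or_concat with rfl | ⟨l', k, rfl⟩
    · simp [evalRev, hm1, hm0]
    · have e : (l'.concat k ++ [m]).reverse ++ [0, 0] = m :: k :: (l'.reverse ++ [0, 0]) := by simp
      obtain ⟨a, b, t, h⟩ := exists_cons_cons l'
      rw [e, h, evalRev, if_neg hm1, if_neg hm0, ← h]
      simp
  rw [key, cfValue_cons _ (by simp), cfValue_append hl hm, toPt, if_neg hpos, one_div_div]
  simp

/-- Because of the leading digit 0, row 0 of `cfm l` holds denominators and row 1 numerators. Column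
0 is the convergent of the whole expansion, column 1 the preceding one, which is the value of `[c,
0]`; the difference of the columns is `[c, -1]`. -/
theorem eval_self {l : List ℤ} (hl : ∀ d ∈ l, 1 ≤ d) :
    eval (0 :: 0 :: l) = toPt (cfm l 1 0) (cfm l 0 0) := by
  rcases l.eq_nil_or_concat with rfl | ⟨l', k, rfl⟩
  · simp [eval, evalRev, cfm_nil, toPt]
  · rw [List.concat_eq_append] at hl ⊢
    rw [eval_append_pos (fun d hd => hl d (by simp [hd])) (hl k (by simp)), cfm_append_zero,
      cfm_append_zero]

theorem eval_zero {l : List ℤ} (hl : ∀ d ∈ l, 1 ≤ d) :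
    eval (0 :: 0 :: (l ++ [0])) = toPt (cfm l 1 1) (cfm l 0 1) := by
  rcases l.eq_nil_or_concat with rfl | ⟨l', k, rfl⟩
  · simp [eval, evalRev, cfm_nil, toPt]
  · rw [List.concat_eq_append] at hl ⊢
    rw [eval_append_zero, eval_self (fun d hd => hl d (by simp [hd])), cfm_append_one,
      cfm_append_one]

theorem eval_neg_one {l : List ℤ} (hl : ∀ d ∈ l, 1 ≤ d) :
    eval (0 :: 0 :: (l ++ [-1])) =
      toPt (cfm l 1 0 - cfm l 1 1) (cfm l 0 0 - cfm l 0 1) := by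
  rcases l.eq_nil_or_concat with rfl | ⟨l', k, rfl⟩
  · simp [eval, evalRev, cfm_nil, toPt]
  · rw [List.concat_eq_append] at hl ⊢
    have hl' : ∀ d ∈ l', 1 ≤ d := fun d hd => hl d (by simp [hd])
    have hk := hl k (by simp)
    rw [eval_append_neg_one, cfm_append_zero, cfm_append_zero, cfm_append_one, cfm_append_one]
    rcases hk.eq_or_lt with rfl | hk
    · rw [sub_self, eval_zero hl']
      congr 1 <;> ring
    · rw [eval_append_pos hl' (by lia)]
      congr 1 <;> ring

/-- The identity `[c, m, 1] = [c, m + 1]` lets results about the first successor of `[c, m]` drive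
the inductions from m to m + 1. -/
theorem eval_append_one {l : List ℤ} (hl : ∀ d ∈ l, 1 ≤ d) {m : ℤ} (hm : 1 ≤ m) :
    eval (0 :: 0 :: (l ++ [m] ++ [1])) = eval (0 :: 0 :: (l ++ [m + 1])) := by
  have hl' : ∀ d ∈ l ++ [m], 1 ≤ d := by
    intro d hd
    rcases List.mem_append.1 hd with h | h
    · exact hl d h
    · simp at h; lia
  rw [eval_append_pos hl' le_rfl, eval_append_pos hl (by lia)]
  simp only [cfm_append_zero, cfm_append_one]
  congr 1 <;> ring

/-- The value of `[c, m]` for `m ≥ 0`. -/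
theorem eval_append_nonneg {l : List ℤ} (hl : ∀ d ∈ l, 1 ≤ d) {m : ℤ} (hm : 0 ≤ m) :
    eval (0 :: 0 :: (l ++ [m])) =
      toPt (m * cfm l 1 0 + cfm l 1 1) (m * cfm l 0 0 + cfm l 0 1) := by
  rcases hm.eq_or_lt with rfl | hm
  · rw [eval_zero hl]; simp
  · exact eval_append_pos hl hm

theorem den_toPt {p q p' q' : ℤ} (hq : 0 ≤ q) (hdet : |p' * q - p * q'| = 1) :
    (den (toPt p q) : ℤ) = q := by
  rcases hq.eq_or_lt with rfl | hq
  · simp [toPt, den]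
  · rw [toPt, if_neg hq.ne']
    rcases (abs_eq zero_le_one).1 hdet with h | h
    · exact den_div_of_det hq h
    · exact den_div_of_det (p' := -p') (q' := -q') hq (by linarith)

theorem abs_cfm_det (l : List ℤ) :
    |cfm l 1 1 * cfm l 0 0 - cfm l 1 0 * cfm l 0 1| = 1 := by
  rw [mul_comm, mul_comm (cfm l 1 0), cfm_det]
  simp

theorem den_eval {l : List ℤ} (hl : ∀ d ∈ l, 1 ≤ d) :
    (den (eval (0 :: 0 :: l)) : ℤ) = cfm l 0 0 := by
  rw [eval_self hl]
  exact den_toPt (by linarith [one_le_cfm hl]) (abs_cfm_det l)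

theorem den_eval_append {l : List ℤ} (hl : ∀ d ∈ l, 1 ≤ d) {m : ℕ} :
    den (eval (0 :: 0 :: (l ++ [(m : ℤ)]))) =
      m * den (eval (0 :: 0 :: l)) + den (eval (0 :: 0 :: (l ++ [0]))) := by
  have h1 : (den (eval (0 :: 0 :: (l ++ [0]))) : ℤ) = cfm l 0 1 := by
    rw [eval_zero hl]
    refine den_toPt (p' := cfm l 1 0) (q' := cfm l 0 0) (cfm_nonneg hl) ?_
    rw [← abs_cfm_det l, abs_sub_comm]
  have h2 : (den (eval (0 :: 0 :: (l ++ [(m : ℤ)]))) : ℤ) = m * cfm l 0 0 + cfm l 0 1 := by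
    rw [eval_append_nonneg hl (by lia)]
    refine den_toPt (p' := cfm l 1 0) (q' := cfm l 0 0) ?_ ?_
    · have := one_le_cfm hl
      have := cfm_nonneg hl
      positivity
    · rw [← abs_cfm_det l, abs_sub_comm]
      congr 1; ring
  have h3 := den_eval hl
  zify
  rw [h1, h2, h3]

theorem one_le_den_eval {l : List ℤ} (hl : ∀ d ∈ l, 1 ≤ d) : 1 ≤ den (eval (0 :: 0 :: l)) := by
  have := den_eval hl
  have := one_le_cfm hl
  lia

/-- For m ≥ 1, `[c, m]` is the mediant of `c` and `[c, m - 1]`, and `[c, m + 1]` that of `c` and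
`[c, m]`. For m = 0 the roles shift: `c` itself is the mediant of `[c, -1]` and `[c, 0]`. The parity
of the length decides which neighbour is on the left. -/
theorem discr_succ {l : List ℤ} (hl : ∀ d ∈ l, 1 ≤ d) {m : ℤ} (hm : 0 ≤ m) (E V : ℝ) :
    discr (0 :: 0 :: (l ++ [m + 1])) E V =
      discr (0 :: 0 :: l) E V * discr (0 :: 0 :: (l ++ [m])) E V -
        discr (0 :: 0 :: (l ++ [m - 1])) E V := by
  have hQ := one_le_cfm hl
  have hQ' := cfm_nonneg hl
  have hd := cfm_det l
  simp only [discr]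
  rw [eval_append_pos hl (by lia : 1 ≤ m + 1), eval_append_nonneg hl hm, eval_self hl]
  rcases hm.eq_or_lt with rfl | hm
  · rw [zero_sub, eval_neg_one hl]
    rcases neg_one_pow_eq_or ℤ l.length with h | h
    · have hlt : 1 ≤ cfm l 0 0 - cfm l 0 1 := by
        rcases cfm_pos hl with rfl | ⟨h1, h2, h3, h4⟩
        · simp [cfm_nil]
        · by_contra hcon
          have h5 : cfm l 0 1 = cfm l 0 0 := by lia
          rw [h, h5, ← mul_sub] at hd
          nlinarith
      have := tr_two_right (p := cfm l 1 0 - cfm l 1 1) (q := cfm l 0 0 - cfm l 0 1)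
        (p' := cfm l 1 1) (q' := cfm l 0 1) hlt hQ' (by rw [← h, ← hd]; ring) E V
      simp only [tr] at this
      convert this using 4 <;> ring_nf
    · have h1 : 1 ≤ cfm l 0 1 ∧ cfm l 0 1 ≤ cfm l 0 0 := by
        rcases cfm_pos hl with rfl | ⟨h1, h2, h3, h4⟩
        · norm_num at h
        · exact ⟨h1, h2⟩
      have := tr_two_left (p' := cfm l 1 0 - cfm l 1 1) (q' := cfm l 0 0 - cfm l 0 1)
        (p := cfm l 1 1) (q := cfm l 0 1) h1.1 (by lia) (by linarith) E V
      simp only [tr] at this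
      convert this using 4 <;> ring_nf
  · rw [eval_append_nonneg hl (by lia : 0 ≤ m - 1)]
    have hm1 : 0 ≤ m - 1 := by lia
    rcases neg_one_pow_eq_or ℤ l.length with h | h
    · have := tr_two_left (p := cfm l 1 0) (q := cfm l 0 0)
        (p' := (m - 1) * cfm l 1 0 + cfm l 1 1) (q' := (m - 1) * cfm l 0 0 + cfm l 0 1)
        hQ (by positivity) (by rw [← h, ← hd]; ring) E V
      simp only [tr] at this
      rw [mul_comm (Matrix.trace _)]
      convert this using 4 <;> ring_nf
    · have h1 : 1 ≤ cfm l 0 1 := by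
        rcases cfm_pos hl with rfl | ⟨h1, h2, h3, h4⟩
        · norm_num at h
        · exact h1
      have := tr_two_right (p' := cfm l 1 0) (q' := cfm l 0 0)
        (p := (m - 1) * cfm l 1 0 + cfm l 1 1) (q := (m - 1) * cfm l 0 0 + cfm l 0 1)
        (by nlinarith) (by lia) (by linarith) E V
      simp only [tr] at this
      rw [mul_comm (Matrix.trace _)]
      convert this using 4 <;> ring_nf

theorem discr_nil (E V : ℝ) : discr [0, 0] E V = E := by
  have h : eval [0, 0] = toPt 0 1 := by simp [eval, evalRev, toPt]
  rw [discr, h, transferMatrix_toPt_one, Matrix.trace_fin_two]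
  simp

theorem discr_zero (E V : ℝ) : discr [0, 0, 0] E V = 2 := by
  have h : eval [0, 0, 0] = toPt 1 0 := by simp [eval, evalRev, toPt]
  rw [discr, h, transferMatrix_toPt_zero, Matrix.trace_fin_two]
  norm_num

theorem discr_neg_one (E V : ℝ) : discr [0, 0, -1] E V = E + V := by
  have h : eval [0, 0, -1] = toPt (-1) 1 := by simp [eval, evalRev, toPt]
  rw [discr, h, transferMatrix_toPt_one, Matrix.trace_fin_two]
  simp

/-- The Fricke–Vogt invariant. -/
theorem discr_invariant {l : List ℤ} (hl : ∀ d ∈ l, 1 ≤ d) (m : ℕ) (E V : ℝ) :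
    discr (0 :: 0 :: l) E V ^ 2 + discr (0 :: 0 :: (l ++ [(m : ℤ)])) E V ^ 2 +
      discr (0 :: 0 :: (l ++ [(m : ℤ) - 1])) E V ^ 2 -
      discr (0 :: 0 :: l) E V * discr (0 :: 0 :: (l ++ [(m : ℤ)])) E V *
        discr (0 :: 0 :: (l ++ [(m : ℤ) - 1])) E V = 4 + V ^ 2 := by
  induction l using List.reverseRecOn generalizing m with
  | nil =>
    induction m with
    | zero =>
      simp only [List.nil_append, Nat.cast_zero, zero_sub]
      rw [discr_nil, discr_zero, discr_neg_one]; ring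
    | succ m ih =>
      rw [Nat.cast_succ, discr_succ hl (by lia), add_sub_cancel_right]
      linear_combination ih
  | append_singleton l k ihl =>
    have hl' : ∀ d ∈ l, 1 ≤ d := fun d hd => hl d (by simp [hd])
    have hk := hl k (by simp)
    induction m with
    | zero =>
      -- For m = 0 the three traces of `[c, k]` are those of `[c, k]`, `c` and `[c, k - 1]`, so the
      -- claim is the invariant of the shorter expansion with digit k.
      have h1 : ∀ E V, discr (0 :: 0 :: (l ++ [k] ++ [0])) E V = discr (0 :: 0 :: l) E V := by
        intro E V; rw [discr, discr, eval_append_zero]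
      have h2 : ∀ E V, discr (0 :: 0 :: (l ++ [k] ++ [-1])) E V =
          discr (0 :: 0 :: (l ++ [k - 1])) E V := by
        intro E V; rw [discr, discr, eval_append_neg_one]
      have h3 := ihl hl' k.toNat
      rw [Int.toNat_of_nonneg (by lia)] at h3
      rw [Nat.cast_zero, zero_sub, h1, h2]
      linear_combination h3
    | succ m ih =>
      rw [Nat.cast_succ, discr_succ hl (by lia), add_sub_cancel_right]
      linear_combination ih

end ContinuedFractions

/-! ### Discriminants are monic polynomials in E and jointly continuous -/

section Regularity

open Polynomial

/-- Each step multiplies the top left entry by E - Vω, so it alone has top degree; the trace is then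
monic of degree equal to the period. -/
theorem exists_poly_transferProd (α : ℚ) (V : ℝ) (N : ℕ) :
    ∃ a b c d : ℝ[X], a.Monic ∧ a.natDegree = N + 1 ∧ b.degree < (N + 1 : ℕ) ∧
      c.degree < (N + 1 : ℕ) ∧ d.degree < (N + 1 : ℕ) ∧
      ∀ E, transferProd α E V (N + 1) =
        !![a.eval E, b.eval E; c.eval E, d.eval E] := by
  induction N with
  | zero =>
    refine ⟨X - C (V * mechWord α 0), -1, 1, 0, monic_X_sub_C _, natDegree_X_sub_C _,
      ?_, ?_, ?_, ?_⟩
    · rw [degree_neg, degree_one]; norm_num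
    · rw [degree_one]; norm_num
    · rw [degree_zero]; exact WithBot.bot_lt_coe _
    · intro E
      simp [transferProd, stepMatrix]
  | succ N ih =>
    obtain ⟨a, b, c, d, ha, hda, hb, hc, hd, h⟩ := ih
    set r := V * (mechWord α (N + 1 : ℕ) : ℝ) with hr
    have hX : (X - C r).Monic := monic_X_sub_C r
    have hXd : (X - C r).degree = 1 := degree_X_sub_C r
    have had : a.degree = ((N + 1 : ℕ) : WithBot ℕ) := by rw [degree_eq_natDegree ha.ne_zero, hda]
    have hm : ((X - C r) * a).Monic := hX.mul ha
    have hmd : ((X - C r) * a).natDegree = N + 1 + 1 := by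
      rw [hX.natDegree_mul ha, natDegree_X_sub_C, hda]; ring
    have hmd' : ((X - C r) * a).degree = ((N + 1 + 1 : ℕ) : WithBot ℕ) := by
      rw [degree_eq_natDegree hm.ne_zero, hmd]
    have hlt : ((N + 1 : ℕ) : WithBot ℕ) < ((N + 1 + 1 : ℕ) : WithBot ℕ) := by
      exact_mod_cast Nat.lt_succ_self _
    have hcl : c.degree < ((X - C r) * a).degree := hmd' ▸ hc.trans hlt
    refine ⟨(X - C r) * a - c, (X - C r) * b - d, a, b, hm.sub_of_left hcl, ?_, ?_, ?_,
      hb.trans hlt, ?_⟩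
    · rw [← hmd]
      exact natDegree_eq_of_degree_eq (degree_sub_eq_left_of_degree_lt hcl)
    · refine (degree_sub_le _ _).trans_lt (max_lt ?_ (hd.trans hlt))
      rw [degree_mul, hXd]
      by_cases hb0 : b = 0
      · rw [hb0, degree_zero]; simp
      · rw [degree_eq_natDegree hb0] at hb ⊢
        have : b.natDegree < N + 1 := by exact_mod_cast hb
        exact_mod_cast (by lia : 1 + b.natDegree < N + 1 + 1)
    · rw [had]; exact hlt
    · intro E
      rw [transferProd, h E, stepMatrix, ← hr]
      ext i j
      fin_cases i <;> fin_cases j <;> simp [Matrix.mul_apply, Fin.sum_univ_two] <;> ring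

theorem exists_poly_discr {c : List ℤ} (hc : 1 ≤ den (eval c)) (V : ℝ) :
    ∃ p : ℝ[X], p.Monic ∧ p.natDegree = den (eval c) ∧ ∀ E, p.eval E = discr c E V := by
  simp only [discr]
  rcases h : eval c with _ | r
  · rw [h] at hc; simp [den] at hc
  · have hr : r.den = r.den - 1 + 1 := (Nat.sub_add_cancel r.den_pos).symm
    obtain ⟨a, b, c, d, ha, hda, -, -, hd, h⟩ := exists_poly_transferProd r V (r.den - 1)
    rw [← hr] at hda hd h
    have hda' : a.degree = r.den := by rw [degree_eq_natDegree ha.ne_zero, hda]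
    rw [← hda'] at hd
    refine ⟨a + d, ha.add_of_left hd, ?_, fun E => ?_⟩
    · change _ = r.den
      rw [← hda]
      exact natDegree_eq_of_degree_eq (degree_add_eq_left_of_degree_lt hd)
    · change _ = Matrix.trace (transferProd r E V r.den)
      rw [h, Matrix.trace_fin_two]; simp

theorem continuous_transferProd (α : ℚ) (N : ℕ) :
    Continuous fun p : ℝ × ℝ => transferProd α p.1 p.2 N := by
  induction N with
  | zero => exact continuous_const
  | succ N ih =>
    simp only [transferProd]
    refine Continuous.matrix_mul ?_ ih
    refine continuous_matrix fun i j => ?_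
    fin_cases i <;> fin_cases j <;> simp [stepMatrix] <;> fun_prop

theorem continuous_discr (c : List ℤ) : Continuous fun p : ℝ × ℝ => discr c p.1 p.2 := by
  simp only [discr]
  rcases h : eval c with _ | r
  · simp only [transferMatrix, Matrix.trace_fin_two]
    simp only [Matrix.of_apply, Matrix.cons_val', Matrix.cons_val_zero, Matrix.cons_val_one,
      Matrix.cons_val_fin_one]
    exact continuous_const
  · exact (continuous_transferProd r r.den).matrix_trace

end Regularity

end Sturmian

namespace Sturmian

/-! ### Bands of a polynomial that takes each value in [-2, 2] as often as its degree -/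

section Bands

open Set Polynomial Topology Filter

/-- The set where a discriminant takes values in `[-2, 2]`. -/
def stable (f : ℝ → ℝ) : Set ℝ := {E | f E ∈ Icc (-2 : ℝ) 2}

theorem mem_stable {f : ℝ → ℝ} {E : ℝ} : E ∈ stable f ↔ |f E| ≤ 2 := by
  rw [abs_le]; rfl

/-- `f` is a monic polynomial function of degree `q`. -/
def IsMonicPoly (f : ℝ → ℝ) (q : ℕ) : Prop :=
  ∃ p : ℝ[X], p.Monic ∧ p.natDegree = q ∧ ∀ E, p.eval E = f E

/-- `f` is a monic polynomial function of degree `q ≥ 1` all of whose values in `[-2, 2]` are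
attained `q` times. -/
structure Hyp (f : ℝ → ℝ) (q : ℕ) : Prop where
  poly : IsMonicPoly f q
  pos : 1 ≤ q
  card : ∀ w ∈ Icc (-2 : ℝ) 2, q ≤ {E | f E = w}.ncard

variable {f : ℝ → ℝ} {q : ℕ}

theorem IsMonicPoly.continuous (h : IsMonicPoly f q) : Continuous f := by
  obtain ⟨p, -, -, hp⟩ := h
  have : f = fun E => p.eval E := funext fun E => (hp E).symm
  rw [this]
  exact p.continuous

theorem IsMonicPoly.exists_sub (h : IsMonicPoly f q) (hq : 1 ≤ q) (w : ℝ) :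
    ∃ p : ℝ[X], p ≠ 0 ∧ p.natDegree = q ∧ (∀ E, p.eval E = f E - w) ∧
      {E | f E = w} = (p.roots.toFinset : Set ℝ) := by
  obtain ⟨p, hm, hd, hp⟩ := h
  have hd' : (p - C w).natDegree = q := by rw [natDegree_sub_C, hd]
  have hne : p - C w ≠ 0 := by
    intro h0
    rw [h0, natDegree_zero] at hd'
    lia
  refine ⟨p - C w, hne, hd', fun E => by simp [hp], ?_⟩
  ext E
  simp [mem_roots hne, IsRoot, hp, sub_eq_zero]

theorem IsMonicPoly.finite (h : IsMonicPoly f q) (hq : 1 ≤ q) (w : ℝ) : {E | f E = w}.Finite := by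
  obtain ⟨p, -, -, -, hs⟩ := h.exists_sub hq w
  rw [hs]
  exact Finset.finite_toSet _

theorem IsMonicPoly.ncard_le (h : IsMonicPoly f q) (hq : 1 ≤ q) (w : ℝ) :
    {E | f E = w}.ncard ≤ q := by
  obtain ⟨p, -, hd, -, hs⟩ := h.exists_sub hq w
  rw [hs, ncard_coe_finset, ← hd]
  exact (Multiset.toFinset_card_le _).trans (card_roots' _)

theorem IsMonicPoly.isCompact_stable (h : IsMonicPoly f q) (hq : 1 ≤ q) :
    IsCompact (stable f) := by
  have hc : IsClosed (stable f) := isClosed_Icc.preimage h.continuous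
  obtain ⟨p, hm, hd, hp⟩ := h
  have ht : Tendsto (fun E => ‖p.eval E‖) (cocompact ℝ) atTop :=
    p.tendsto_norm_atTop (by rw [degree_eq_natDegree hm.ne_zero, hd]; exact_mod_cast hq)
      tendsto_norm_cocompact_atTop
  have h2 := ht.eventually (eventually_gt_atTop 2)
  rw [← Metric.cobounded_eq_cocompact] at h2
  refine Metric.isCompact_of_isClosed_isBounded hc (Bornology.isBounded_def.2 ?_)
  filter_upwards [h2] with E hE hE'
  rw [hp, Real.norm_eq_abs] at hE
  exact hE.not_ge (mem_stable.1 hE')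

/-- The q distinct solutions of f = f(E) already use up the degree, so each is a simple root. -/
theorem Hyp.deriv_ne_zero (h : Hyp f q) {E : ℝ} (hE : E ∈ stable f) :
    ∃ f', f' ≠ 0 ∧ HasDerivAt f f' E := by
  obtain ⟨p, hne, hd, hp, hs⟩ := h.poly.exists_sub h.pos (f E)
  have hcard := h.card (f E) hE
  rw [hs, ncard_coe_finset] at hcard
  have hnodup : p.roots.Nodup := by
    rw [← Multiset.toFinset_card_eq_card_iff_nodup]
    exact le_antisymm (Multiset.toFinset_card_le _) (((card_roots' p).trans hd.le).trans hcard)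
  have hroot : p.IsRoot E := by rw [IsRoot, hp, sub_self]
  have hmult : ¬ 1 < p.rootMultiplicity E := by
    rw [← count_roots, not_lt]
    exact Multiset.nodup_iff_count_le_one.1 hnodup E
  rw [one_lt_rootMultiplicity_iff_isRoot hne] at hmult
  refine ⟨p.derivative.eval E, fun h0 => hmult ⟨hroot, h0⟩, ?_⟩
  have h1 := (p.hasDerivAt E).add_const (f E)
  have h2 : (fun x => p.eval x + f E) = f := by funext x; rw [hp]; ring
  rwa [h2] at h1

/-- `[a, b]` is an interval on which `f` is strictly monotone from `∓ 2` to `± 2`. -/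
structure Crossing (f : ℝ → ℝ) (a b : ℝ) : Prop where
  lt : a < b
  cont : ContinuousOn f (Icc a b)
  mono : (StrictMonoOn f (Icc a b) ∧ f a = -2 ∧ f b = 2) ∨
    (StrictAntiOn f (Icc a b) ∧ f a = 2 ∧ f b = -2)

theorem Crossing.injOn {a b : ℝ} (h : Crossing f a b) : InjOn f (Icc a b) := by
  rcases h.mono with h | h
  · exact h.1.injOn
  · exact h.1.injOn

theorem Crossing.surj {a b w : ℝ} (h : Crossing f a b) (hw : w ∈ Icc (-2 : ℝ) 2) :
    ∃ E ∈ Icc a b, f E = w := by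
  rcases h.mono with ⟨-, h1, h2⟩ | ⟨-, h1, h2⟩
  · exact intermediate_value_Icc h.lt.le h.cont (by rwa [h1, h2])
  · exact intermediate_value_Icc' h.lt.le h.cont (by rwa [h1, h2])

theorem Crossing.subset {a b : ℝ} (h : Crossing f a b) : Icc a b ⊆ stable f := by
  intro E hE
  have ha := left_mem_Icc.2 h.lt.le
  have hb := right_mem_Icc.2 h.lt.le
  rcases h.mono with ⟨h0, h1, h2⟩ | ⟨h0, h1, h2⟩
  · exact ⟨h1 ▸ h0.monotoneOn ha hE hE.1, h2 ▸ h0.monotoneOn hE hb hE.2⟩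
  · exact ⟨h2 ▸ h0.antitoneOn hE hb hE.2, h1 ▸ h0.antitoneOn ha hE hE.1⟩

theorem Crossing.abs_left {a b : ℝ} (h : Crossing f a b) : |f a| = 2 := by
  rcases h.mono with ⟨-, h1, -⟩ | ⟨-, h1, -⟩ <;> rw [h1] <;> norm_num

theorem Crossing.abs_right {a b : ℝ} (h : Crossing f a b) : |f b| = 2 := by
  rcases h.mono with ⟨-, -, h1⟩ | ⟨-, -, h1⟩ <;> rw [h1] <;> norm_num

theorem Crossing.mem_Ioo {a b E : ℝ} (h : Crossing f a b) (hE : E ∈ Icc a b) (hf : |f E| < 2) :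
    E ∈ Ioo a b := by
  refine ⟨hE.1.lt_of_ne ?_, hE.2.lt_of_ne ?_⟩
  · rintro rfl; exact hf.ne h.abs_left
  · rintro rfl; exact hf.ne h.abs_right

theorem exists_right {E : ℝ} (hcf : Continuous f) (hE : |f E| < 2) :
    ∃ x, E < x ∧ Icc E x ⊆ stable f := by
  have h1 : ∀ᶠ x in 𝓝 E, |f x| < 2 := hcf.abs.continuousAt.eventually_lt_const hE
  obtain ⟨ε, hε, h⟩ := Metric.eventually_nhds_iff.1 h1
  refine ⟨E + ε / 2, by linarith, fun x hx => mem_stable.2 (h ?_).le⟩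
  rw [Real.dist_eq, abs_lt]
  constructor <;> linarith [hx.1, hx.2]

theorem exists_left {E : ℝ} (hcf : Continuous f) (hE : |f E| < 2) :
    ∃ x, x < E ∧ Icc x E ⊆ stable f := by
  have h1 : ∀ᶠ x in 𝓝 E, |f x| < 2 := hcf.abs.continuousAt.eventually_lt_const hE
  obtain ⟨ε, hε, h⟩ := Metric.eventually_nhds_iff.1 h1
  refine ⟨E - ε / 2, by linarith, fun x hx => mem_stable.2 (h ?_).le⟩
  rw [Real.dist_eq, abs_lt]
  constructor <;> linarith [hx.1, hx.2]

/-- A point of `stable f` with non-zero derivative is not isolated in `stable f`. -/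
theorem exists_segment {f' E : ℝ} (hcf : Continuous f) (hE : E ∈ stable f) (hf' : f' ≠ 0)
    (hd : HasDerivAt f f' E) : ∃ x, x ≠ E ∧ uIcc x E ⊆ stable f := by
  have h1 : ∀ᶠ x in 𝓝[≠] E, 0 < (f x - f E) * ((x - E) * f') := by
    have ht := ((hasDerivAt_iff_tendsto_slope.1 hd).mul_const f').eventually_const_lt
      (mul_self_pos.2 hf')
    filter_upwards [ht, self_mem_nhdsWithin] with x hx hxE
    have hxE' : x - E ≠ 0 := sub_ne_zero.2 hxE
    have h3 : (f x - f E) * ((x - E) * f') = slope f E x * f' * (x - E) ^ 2 := by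
      rw [slope_def_field]; field_simp
    rw [h3]
    positivity
  have h2 : ∀ᶠ x in 𝓝 E, |f x - f E| < 1 := by
    have hc : Continuous fun x => |f x - f E| := (hcf.sub continuous_const).abs
    exact hc.continuousAt.eventually_lt_const (by simp)
  rw [eventually_nhdsWithin_iff] at h1
  obtain ⟨ε, hε, h⟩ := Metric.eventually_nhds_iff.1 (h1.and h2)
  have hin : ∀ y, |y - E| ≤ ε / 2 → dist y E < ε := fun y hy => by
    rw [Real.dist_eq]; linarith
  have hpos : ∀ y, y ≠ E → |y - E| ≤ ε / 2 → 0 < (f y - f E) * ((y - E) * f') :=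
    fun y hy hy' => (h (hin y hy')).1 hy
  have hnear : ∀ y, |y - E| ≤ ε / 2 → |f y - f E| < 1 := fun y hy => (h (hin y hy)).2
  rcases (mem_stable.1 hE).lt_or_eq with hlt | heq
  · obtain ⟨x, hx, hxs⟩ := exists_right hcf hlt
    exact ⟨x, hx.ne', by rwa [uIcc_of_ge hx.le]⟩
  -- At an edge value ±2, the function re-enters [-2, 2] to the right or to the left according to
  -- the sign of f(E) f'(E).
  have hright : f E * f' < 0 → Icc E (E + ε / 2) ⊆ stable f := by
    intro hs y hy
    rcases hy.1.eq_or_lt with rfl | hlt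
    · exact hE
    have hy' : |y - E| ≤ ε / 2 := by rw [abs_le]; constructor <;> linarith [hy.2]
    have h3 := hpos y hlt.ne' hy'
    have h4 := abs_lt.1 (hnear y hy')
    rcases (abs_eq zero_le_two).1 heq with h5 | h5
    · have hf : f' < 0 := by rw [h5] at hs; linarith
      have := (neg_iff_neg_of_mul_pos h3).2 (mul_neg_of_pos_of_neg (sub_pos.2 hlt) hf)
      constructor <;> linarith
    · have hf : 0 < f' := by rw [h5] at hs; linarith
      have := (pos_iff_pos_of_mul_pos h3).2 (mul_pos (sub_pos.2 hlt) hf)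
      constructor <;> linarith
  have hleft : 0 < f E * f' → Icc (E - ε / 2) E ⊆ stable f := by
    intro hs y hy
    rcases hy.2.eq_or_lt with rfl | hlt
    · exact hE
    have hy' : |y - E| ≤ ε / 2 := by rw [abs_le]; constructor <;> linarith [hy.1]
    have h3 := hpos y hlt.ne hy'
    have h4 := abs_lt.1 (hnear y hy')
    rcases (abs_eq zero_le_two).1 heq with h5 | h5
    · have hf : 0 < f' := by rw [h5] at hs; linarith
      have := (neg_iff_neg_of_mul_pos h3).2 (mul_neg_of_neg_of_pos (sub_neg.2 hlt) hf)
      constructor <;> linarith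
    · have hf : f' < 0 := by rw [h5] at hs; linarith
      have := (pos_iff_pos_of_mul_pos h3).2 (mul_pos_of_neg_of_neg (sub_neg.2 hlt) hf)
      constructor <;> linarith
  have hfE : f E ≠ 0 := by rw [← abs_pos, heq]; norm_num
  rcases (mul_ne_zero hfE hf').lt_or_gt with hs | hs
  · exact ⟨E + ε / 2, by linarith, by rw [uIcc_of_ge (by linarith)]; exact hright hs⟩
  · exact ⟨E - ε / 2, by linarith, by rw [uIcc_of_le (by linarith)]; exact hleft hs⟩

theorem Hyp.component (h : Hyp f q) {E : ℝ} (hE : E ∈ stable f) :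
    ∃ a b, Crossing f a b ∧ E ∈ Icc a b ∧ connectedComponentIn (stable f) E = Icc a b := by
  have hcf := h.poly.continuous
  set S := connectedComponentIn (stable f) E with hS
  have hconn : IsConnected S := isConnected_connectedComponentIn_iff.2 hE
  have hES : E ∈ S := mem_connectedComponentIn hE
  have hsub : S ⊆ stable f := connectedComponentIn_subset _ _
  have hclosed : IsClosed S := by
    refine isClosed_of_closure_subset ?_
    refine (hconn.isPreconnected.closure).subset_connectedComponentIn (subset_closure hES) ?_
    exact closure_minimal hsub (isClosed_Icc.preimage hcf)
  have hcomp : IsCompact S := (h.poly.isCompact_stable h.pos).of_isClosed_subset hclosed hsub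
  obtain ⟨a, b, hab⟩ : ∃ a b, S = Icc a b := ⟨_, _, eq_Icc_of_connected_compact hconn hcomp⟩
  have hmax : ∀ x y z, z ∈ Icc a b → z ∈ Icc x y → Icc x y ⊆ stable f → Icc x y ⊆ Icc a b := by
    intro x y z hz hz' hxy
    rw [← hab] at hz ⊢
    rw [hS, connectedComponentIn_eq hz]
    exact isPreconnected_Icc.subset_connectedComponentIn hz' hxy
  have hEab : E ∈ Icc a b := hab ▸ hES
  have hle : a ≤ b := hEab.1.trans hEab.2
  rw [hab] at hsub
  have hlt : a < b := by
    refine hle.lt_of_ne fun hne => ?_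
    obtain ⟨f', hf', hd⟩ := h.deriv_ne_zero (hsub (left_mem_Icc.2 hle))
    obtain ⟨x, hx, hxs⟩ := exists_segment hcf (hsub (left_mem_Icc.2 hle)) hf' hd
    have h1 := hmax _ _ a (left_mem_Icc.2 hle) (right_mem_uIcc : a ∈ uIcc x a) hxs
    have h2 := h1 (left_mem_uIcc : x ∈ uIcc x a)
    rw [← hne, Icc_self] at h2
    exact hx h2
  -- By Rolle, two equal values would give a zero of the derivative inside the stable set.
  have hinj : InjOn f (Icc a b) := by
    have key : ∀ x ∈ Icc a b, ∀ y ∈ Icc a b, x < y → f x ≠ f y := by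
      intro x hx y hy hxy heq
      obtain ⟨z, hz, hz'⟩ := exists_deriv_eq_zero hxy hcf.continuousOn heq
      have hzs : z ∈ Icc a b := ⟨hx.1.trans hz.1.le, hz.2.le.trans hy.2⟩
      obtain ⟨f', hf', hd⟩ := h.deriv_ne_zero (hsub hzs)
      exact hf' (hd.deriv ▸ hz')
    intro x hx y hy heq
    by_contra hne
    rcases lt_or_gt_of_ne hne with hlt | hlt
    · exact key x hx y hy hlt heq
    · exact key y hy x hx hlt heq.symm
  -- If |f| < 2 at an end, the component could be enlarged.
  have hal : |f a| = 2 := by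
    refine le_antisymm (mem_stable.1 (hsub (left_mem_Icc.2 hle))) (not_lt.1 fun hlt' => ?_)
    obtain ⟨x, hx, hxs⟩ := exists_left hcf hlt'
    have := hmax _ _ a (left_mem_Icc.2 hle) (right_mem_Icc.2 hx.le) hxs (left_mem_Icc.2 hx.le)
    exact hx.not_ge this.1
  have hbr : |f b| = 2 := by
    refine le_antisymm (mem_stable.1 (hsub (right_mem_Icc.2 hle))) (not_lt.1 fun hlt' => ?_)
    obtain ⟨x, hx, hxs⟩ := exists_right hcf hlt'
    have := hmax _ _ b (right_mem_Icc.2 hle) (left_mem_Icc.2 hx.le) hxs (right_mem_Icc.2 hx.le)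
    exact hx.not_ge this.2
  refine ⟨a, b, ⟨hlt, hcf.continuousOn, ?_⟩, hEab, hab⟩
  have hal' := (abs_eq zero_le_two).1 hal
  have hbr' := (abs_eq zero_le_two).1 hbr
  rcases hcf.continuousOn.strictMonoOn_of_injOn_Icc' hle hinj with hm | hm
  · have := hm (left_mem_Icc.2 hle) (right_mem_Icc.2 hle) hlt
    left; refine ⟨hm, ?_, ?_⟩ <;> rcases hal' with h1 | h1 <;> rcases hbr' with h2 | h2 <;> linarith
  · have := hm (left_mem_Icc.2 hle) (right_mem_Icc.2 hle) hlt
    right; refine ⟨hm, ?_, ?_⟩ <;> rcases hal' with h1 | h1 <;> rcases hbr' with h2 | h2 <;> linarith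

/-- The bands of `f`, sorted, with their zeros. -/
structure BandSystem (f : ℝ → ℝ) (q : ℕ) (e a b : Fin q → ℝ) : Prop where
  crossing : ∀ i, Crossing f (a i) (b i)
  zero : ∀ i, f (e i) = 0
  mem : ∀ i, e i ∈ Ioo (a i) (b i)
  lt : ∀ i j, i < j → b i < a j
  comp : ∀ i, ∀ E ∈ Icc (a i) (b i), connectedComponentIn (stable f) E = Icc (a i) (b i)
  cover : ∀ E ∈ stable f, ∃ i, E ∈ Icc (a i) (b i)

theorem Hyp.ncard_eq (h : Hyp f q) {w : ℝ} (hw : w ∈ Icc (-2 : ℝ) 2) : {E | f E = w}.ncard = q :=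
  le_antisymm (h.poly.ncard_le h.pos w) (h.card w hw)

theorem Hyp.exists_bandSystem (h : Hyp f q) : ∃ e a b, BandSystem f q e a b := by
  have h0 : (0 : ℝ) ∈ Icc (-2 : ℝ) 2 := by norm_num
  have hfin := h.poly.finite h.pos 0
  have hcard : hfin.toFinset.card = q := by
    rw [← ncard_eq_toFinset_card _ hfin, h.ncard_eq h0]
  let e := hfin.toFinset.orderEmbOfFin hcard
  have he : ∀ i, f (e i) = 0 := fun i => by
    have := hfin.toFinset.orderEmbOfFin_mem hcard i
    rwa [Finite.mem_toFinset] at this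
  have hes : ∀ i, e i ∈ stable f := fun i => by
    rw [mem_stable, he]; norm_num
  choose a b hab hmem hcomp using fun i => h.component (hes i)
  have hcomp' : ∀ i, ∀ E ∈ Icc (a i) (b i),
      connectedComponentIn (stable f) E = Icc (a i) (b i) := by
    intro i E hE
    rw [← hcomp i] at hE ⊢
    exact (connectedComponentIn_eq hE).symm
  have hdisj : ∀ i j E, E ∈ Icc (a i) (b i) → E ∈ Icc (a j) (b j) → i = j := by
    intro i j E hi hj
    have heq : Icc (a i) (b i) = Icc (a j) (b j) := (hcomp' i E hi).symm.trans (hcomp' j E hj)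
    have := (hab i).injOn (hmem i) (heq ▸ hmem j) ((he i).trans (he j).symm)
    exact e.injective this
  refine ⟨e, a, b, hab, he, fun i => (hab i).mem_Ioo (hmem i) (by rw [he]; norm_num),
    fun i j hij => ?_, hcomp', fun E hE => ?_⟩
  · by_contra hcon
    rw [not_lt] at hcon
    have h1 : e i < e j := e.strictMono hij
    rcases le_total (a j) (a i) with h2 | h2
    · exact hij.ne (hdisj i j (e i) (hmem i) ⟨h2.trans (hmem i).1, h1.le.trans (hmem j).2⟩)
    · exact hij.ne (hdisj i j (a j) ⟨h2, hcon⟩ (left_mem_Icc.2 (hab j).lt.le))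
  · obtain ⟨x, y, hxy, hE', hc⟩ := h.component hE
    obtain ⟨z, hz, hz0⟩ := hxy.surj h0
    have hzr : z ∈ Set.range e := by
      rw [Finset.range_orderEmbOfFin]
      simpa using hz0
    obtain ⟨i, rfl⟩ := hzr
    refine ⟨i, ?_⟩
    rw [← hcomp i, ← connectedComponentIn_eq (hc.symm ▸ hz)]
    exact mem_connectedComponentIn hE

variable {e a b : Fin q → ℝ}

theorem BandSystem.disjoint (h : BandSystem f q e a b) {i j : Fin q} {E : ℝ}
    (hi : E ∈ Icc (a i) (b i)) (hj : E ∈ Icc (a j) (b j)) : i = j := by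
  rcases lt_trichotomy i j with hij | hij | hij
  · exact absurd (h.lt i j hij) (not_lt.2 (hj.1.trans hi.2))
  · exact hij
  · exact absurd (h.lt j i hij) (not_lt.2 (hi.1.trans hj.2))

theorem BandSystem.strictMono (h : BandSystem f q e a b) : StrictMono e := fun i j hij =>
  (h.mem i).2.trans ((h.lt i j hij).trans (h.mem j).1)

/-- The points of a finite set in `stable f` are counted band by band. -/
theorem BandSystem.ncard_inter (h : BandSystem f q e a b) {R : Set ℝ} (hR : R.Finite) :
    (R ∩ stable f).ncard = ∑ i, (R ∩ Icc (a i) (b i)).ncard := by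
  have h1 : R ∩ stable f = ⋃ i ∈ (Finset.univ : Finset (Fin q)), R ∩ Icc (a i) (b i) := by
    ext E
    simp only [mem_inter_iff, mem_iUnion, Finset.mem_univ, exists_true_left]
    constructor
    · rintro ⟨h1, h2⟩
      obtain ⟨i, hi⟩ := h.cover E h2
      exact ⟨i, h1, hi⟩
    · rintro ⟨i, h1, hi⟩
      exact ⟨h1, (h.crossing i).subset hi⟩
  rw [h1]
  simp only [Finset.mem_univ, iUnion_true]
  rw [ncard_iUnion_of_finite (fun i => hR.subset inter_subset_left), finsum_eq_sum_of_fintype]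
  intro i j hij
  exact disjoint_left.2 fun E hi hj => hij (h.disjoint hi.2 hj.2)

end Bands

end Sturmian

namespace Sturmian

/-! ### The recursion along a fixed trace: exclusion, growth at edges, nodes -/

section TraceSequences

open Set Real

/-- Three traces with the Fricke–Vogt invariant `4 + V ^ 2`, `V > 4`, are not all in
`[-2, 2]`. -/
theorem not_all_le_two {V x y z : ℝ} (hV : 4 < V)
    (h : x ^ 2 + y ^ 2 + z ^ 2 - x * y * z = 4 + V ^ 2) (hx : |x| ≤ 2) (hy : |y| ≤ 2) :
    2 < |z| := by
  by_contra hz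
  rw [not_lt] at hz
  have h1 : |x * y * z| ≤ 2 * 2 * 2 := by
    rw [abs_mul, abs_mul]; gcongr
  have h2 := (abs_le.1 h1).1
  have hx' := sq_le_sq' (abs_le.1 hx).1 (abs_le.1 hx).2
  have hy' := sq_le_sq' (abs_le.1 hy).1 (abs_le.1 hy).2
  have hz' := sq_le_sq' (abs_le.1 hz).1 (abs_le.1 hz).2
  nlinarith

/-- A sequence of trace functions along a fixed trace function `f`. -/
structure TraceSeq (V : ℝ) (f : ℝ → ℝ) (z : ℕ → ℝ → ℝ) : Prop where
  contf : Continuous f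
  cont : ∀ m, Continuous (z m)
  recur : ∀ m E, z (m + 2) E = f E * z (m + 1) E - z m E
  inv : ∀ E, f E ^ 2 + z 0 E ^ 2 + z 1 E ^ 2 - f E * z 0 E * z 1 E = 4 + V ^ 2

variable {V : ℝ} {f : ℝ → ℝ} {z : ℕ → ℝ → ℝ}

theorem TraceSeq.invariant (h : TraceSeq V f z) (m : ℕ) (E : ℝ) :
    f E ^ 2 + z m E ^ 2 + z (m + 1) E ^ 2 - f E * z m E * z (m + 1) E = 4 + V ^ 2 := by
  induction m with
  | zero => exact h.inv E
  | succ m ih => rw [h.recur]; linear_combination ih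

theorem TraceSeq.excl (h : TraceSeq V f z) (hV : 4 < V) {m : ℕ} {E : ℝ} (hf : |f E| ≤ 2)
    (hz : |z m E| ≤ 2) : 2 < |z (m + 1) E| :=
  not_all_le_two hV (h.invariant m E) hf hz

/-- The quantity f z₀ - z₁ is the term z₋₁ of the sequence continued backwards, and the invariant
holds for it as well. -/
theorem TraceSeq.excl_prev (h : TraceSeq V f z) (hV : 4 < V) {E : ℝ} (hf : |f E| ≤ 2)
    (hz : |z 0 E| ≤ 2) : 2 < |f E * z 0 E - z 1 E| :=
  not_all_le_two (y := z 0 E) hV (by linear_combination h.inv E) hf hz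

/-- For f = ±2 the characteristic polynomial of the recursion has the double root s = ±1. -/
theorem TraceSeq.edge_formula (h : TraceSeq V f z) {E s : ℝ} (hs : s * s = 1)
    (hf : f E = 2 * s) (m : ℕ) : z m E = s ^ m * (z 0 E + m * (s * z 1 E - z 0 E)) := by
  have key : z m E = s ^ m * (z 0 E + m * (s * z 1 E - z 0 E)) ∧
      z (m + 1) E = s ^ (m + 1) * (z 0 E + (m + 1 : ℕ) * (s * z 1 E - z 0 E)) := by
    induction m with
    | zero => constructor <;> simp; linear_combination (-z 1 E) * hs
    | succ m ih =>
      refine ⟨ih.2, ?_⟩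
      rw [h.recur, ih.1, ih.2, hf]
      push_cast
      ring_nf
      linear_combination (z 0 E + m * (s * z 1 E - z 0 E)) * s ^ m * hs
  exact key.1

/-- At the edges of the stable set of `f`, the sequence grows linearly. -/
theorem TraceSeq.edge (h : TraceSeq V f z) (hV : 4 < V) {E : ℝ} (hf : |f E| = 2)
    (hz : |z 0 E| ≤ 2) (m : ℕ) : 2 < |z (m + 1) E| := by
  obtain ⟨s, hs, hfs⟩ : ∃ s : ℝ, s * s = 1 ∧ f E = 2 * s := by
    rcases (abs_eq zero_le_two).1 hf with h | h
    · exact ⟨1, by norm_num, by linarith⟩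
    · exact ⟨-1, by norm_num, by linarith⟩
  have habs : |s| = 1 := by
    rw [← abs_mul_self, abs_mul] at hs
    nlinarith [abs_nonneg s]
  rw [h.edge_formula hs hfs, abs_mul, abs_pow, habs, one_pow, one_mul]
  -- With f = 2s the invariant is a perfect square. The slope of the linear growth is therefore ±V,
  -- and |z_{m+1}| ≥ (m+1)V - 2 > 2.
  have hd : (s * z 1 E - z 0 E) ^ 2 = V ^ 2 := by
    have := h.inv E
    rw [hfs] at this
    linear_combination this + (z 1 E ^ 2 - 4) * hs
  have hd' : |s * z 1 E - z 0 E| = V := by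
    rw [← abs_of_pos (by linarith : 0 < V)]
    exact (sq_eq_sq_iff_abs_eq_abs _ _).1 hd
  have h1 : V ≤ |((m + 1 : ℕ) : ℝ) * (s * z 1 E - z 0 E)| := by
    rw [abs_mul, hd', Nat.abs_cast]
    push_cast
    nlinarith [(Nat.cast_nonneg m : (0 : ℝ) ≤ m)]
  have h2 := abs_sub_abs_le_abs_sub (((m + 1 : ℕ) : ℝ) * (s * z 1 E - z 0 E)) (-z 0 E)
  rw [sub_neg_eq_add, abs_neg, add_comm _ (z 0 E)] at h2
  linarith

theorem TraceSeq.sin_formula (h : TraceSeq V f z) {E θ : ℝ} (hf : f E = 2 * cos θ) (m : ℕ) :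
    z m E * sin θ = z 1 E * sin (m * θ) - z 0 E * sin ((m - 1) * θ) := by
  have key : z m E * sin θ = z 1 E * sin (m * θ) - z 0 E * sin ((m - 1) * θ) ∧
      z (m + 1) E * sin θ = z 1 E * sin ((m + 1) * θ) - z 0 E * sin (m * θ) := by
    induction m with
    | zero => simp
    | succ m ih =>
      have e1 : sin (((m + 1 : ℕ) + 1 : ℝ) * θ) =
          2 * cos θ * sin ((m + 1) * θ) - sin (m * θ) := by
        have h1 : ((m + 1 : ℕ) + 1 : ℝ) * θ = (m + 1) * θ + θ := by push_cast; ring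
        have h2 : (m : ℝ) * θ = (m + 1) * θ - θ := by ring
        rw [h1, h2, sin_add, sin_sub]; ring
      have e2 : sin (((m : ℝ) + 1) * θ) = 2 * cos θ * sin (m * θ) - sin ((m - 1) * θ) := by
        have h1 : ((m : ℝ) + 1) * θ = m * θ + θ := by ring
        have h2 : ((m : ℝ) - 1) * θ = m * θ - θ := by ring
        rw [h1, h2, sin_add, sin_sub]; ring
      refine ⟨?_, ?_⟩
      · rw [ih.2]; push_cast; rw [add_sub_cancel_right]
      · rw [h.recur, hf, e1]
        push_cast
        rw [e2] at ih ⊢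
        linear_combination 2 * cos θ * ih.2 - ih.1
  exact key.1

/-- Values of the sequence at the nodes `f = 2 cos (j π / (m + 1))`. -/
theorem TraceSeq.node (h : TraceSeq V f z) {E θ : ℝ} (hf : f E = 2 * cos θ) (hθ : sin θ ≠ 0)
    {m j : ℕ} (hj : (m + 1) * θ = j * π) :
    z (m + 1) E = (-1) ^ j * z 0 E ∧ z m E = (-1) ^ j * (f E * z 0 E - z 1 E) := by
  have s0 : sin ((m + 1) * θ) = 0 := by rw [hj, sin_nat_mul_pi]
  have c0 : cos ((m + 1) * θ) = (-1) ^ j := by rw [hj, cos_nat_mul_pi]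
  have s1 : sin (m * θ) = -((-1) ^ j * sin θ) := by
    have h1 : (m : ℝ) * θ = (m + 1) * θ - θ := by ring
    rw [h1, sin_sub, s0, c0]; ring
  have c1 : cos (m * θ) = (-1) ^ j * cos θ := by
    have h1 : (m : ℝ) * θ = (m + 1) * θ - θ := by ring
    rw [h1, cos_sub, s0, c0]; ring
  have s2 : sin ((m - 1) * θ) = -((-1) ^ j * (2 * cos θ * sin θ)) := by
    have h1 : ((m : ℝ) - 1) * θ = m * θ - θ := by ring
    rw [h1, sin_sub, s1, c1]; ring
  constructor
  · have := h.sin_formula hf (m + 1)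
    push_cast at this
    rw [add_sub_cancel_right, s0, s1] at this
    exact mul_right_cancel₀ hθ (by linear_combination this)
  · have := h.sin_formula hf m
    rw [s1, s2] at this
    rw [hf]
    exact mul_right_cancel₀ hθ (by linear_combination this)

/-- The parametrization of a band by the rotation angle. -/
theorem Crossing.exists_param {a b : ℝ} (h : Crossing f a b) :
    ∃ ρ : ℝ → ℝ, (∀ t ∈ Ioo (0 : ℝ) 1, ρ t ∈ Ioo a b) ∧ StrictMonoOn ρ (Ioo 0 1) ∧
      ((∀ t ∈ Ioo (0 : ℝ) 1, f (ρ t) = 2 * cos (t * π)) ∨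
        (∀ t ∈ Ioo (0 : ℝ) 1, f (ρ t) = 2 * cos ((1 - t) * π))) := by
  have hcos : ∀ θ : ℝ, 2 * cos θ ∈ Icc (-2 : ℝ) 2 := fun θ =>
    ⟨by linarith [neg_one_le_cos θ], by linarith [cos_le_one θ]⟩
  have hcos' : ∀ t ∈ Ioo (0 : ℝ) 1, |2 * cos (t * π)| < 2 := by
    intro t ht
    have h1 : cos (t * π) < cos 0 :=
      cos_lt_cos_of_nonneg_of_le_pi le_rfl (by nlinarith [pi_pos, ht.2]) (by nlinarith [pi_pos, ht.1])
    have h2 : cos π < cos (t * π) :=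
      cos_lt_cos_of_nonneg_of_le_pi (by nlinarith [pi_pos, ht.1]) le_rfl
        (by nlinarith [pi_pos, ht.2])
    rw [cos_zero] at h1
    rw [cos_pi] at h2
    rw [abs_lt]
    constructor <;> linarith
  have hmono : ∀ s ∈ Ioo (0 : ℝ) 1, ∀ t ∈ Ioo (0 : ℝ) 1, s < t → cos (t * π) < cos (s * π) := by
    intro s hs t ht hst
    exact cos_lt_cos_of_nonneg_of_le_pi (by nlinarith [pi_pos, hs.1]) (by nlinarith [pi_pos, ht.2])
      (by nlinarith [pi_pos])
  have hflip : ∀ t ∈ Ioo (0 : ℝ) 1, 1 - t ∈ Ioo (0 : ℝ) 1 := fun t ht =>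
    ⟨by linarith [ht.2], by linarith [ht.1]⟩
  rcases h.mono with ⟨hm, -, -⟩ | ⟨hm, -, -⟩
  · choose ρ hρ hf using fun t : ℝ => h.surj (hcos ((1 - t) * π))
    refine ⟨ρ, fun t ht => h.mem_Ioo (hρ t) ?_, fun s hs t ht hst => ?_, Or.inr fun t _ => hf t⟩
    · rw [hf]; exact hcos' _ (hflip t ht)
    · rw [← hm.lt_iff_lt (hρ s) (hρ t), hf, hf]
      linarith [hmono _ (hflip t ht) _ (hflip s hs) (by linarith)]
  · choose ρ hρ hf using fun t : ℝ => h.surj (hcos (t * π))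
    refine ⟨ρ, fun t ht => h.mem_Ioo (hρ t) ?_, fun s hs t ht hst => ?_, Or.inl fun t _ => hf t⟩
    · rw [hf]; exact hcos' _ ht
    · rw [← hm.lt_iff_gt (hρ t) (hρ s), hf, hf]
      linarith [hmono _ hs _ ht hst]

/-- Interlacing nodes in a band on which the initial trace is at most `2`. -/
theorem TraceSeq.exists_nodes (h : TraceSeq V f z) (hV : 4 < V) {a b : ℝ} (hab : Crossing f a b)
    (hz : ∀ E ∈ Icc a b, |z 0 E| ≤ 2) (M : ℕ) :
    ∃ (P : Fin (M + 1) → ℝ) (Q : Fin M → ℝ),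
      (∀ j, P j ∈ Ioo a b) ∧ (∀ i, Q i ∈ Ioo a b) ∧
      (∀ i, P i.castSucc < Q i ∧ Q i < P i.succ) ∧
      (∀ j, |z (M + 2) (P j)| ≤ 2) ∧ (∀ i, |z (M + 1) (Q i)| ≤ 2) ∧
      (∀ j, 2 < |z (M + 1) (P j)|) ∧
      (∀ i : Fin M, z (M + 1) (P i.castSucc) * z (M + 1) (P i.succ) < 0) := by
  obtain ⟨ρ, hρ, hρm, hρf⟩ := hab.exists_param
  have hy : ∀ E ∈ Icc a b, 2 < |f E * z 0 E - z 1 E| := fun E hE =>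
    h.excl_prev hV (mem_stable.1 (hab.subset hE)) (hz E hE)
  -- The term z₋₁ exceeds 2 in modulus throughout the band, so it cannot change sign there.
  have hsign : ∀ E ∈ Icc a b, ∀ E' ∈ Icc a b,
      0 < (f E * z 0 E - z 1 E) * (f E' * z 0 E' - z 1 E') := by
    intro E hE E' hE'
    by_contra hcon
    have hcy : Continuous fun E => f E * z 0 E - z 1 E := (h.contf.mul (h.cont 0)).sub (h.cont 1)
    have h0 : (0 : ℝ) ∈ uIcc (f E * z 0 E - z 1 E) (f E' * z 0 E' - z 1 E') := by
      rw [mem_uIcc]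
      rcases mul_nonpos_iff.1 (not_lt.1 hcon) with h1 | h1
      · exact Or.inr ⟨h1.2, h1.1⟩
      · exact Or.inl h1
    obtain ⟨x, hx, hx0⟩ := intermediate_value_uIcc hcy.continuousOn h0
    have := hy x (uIcc_subset_Icc hE hE' hx)
    simp only at hx0
    rw [hx0, abs_zero] at this
    linarith
  -- values at the node `j / (m + 1)`
  have node : ∃ ε : ℕ → ℝ, (∀ m, ε m = 1 ∨ ε m = -1) ∧ ∀ m j : ℕ, 1 ≤ j → j ≤ m →
      z (m + 1) (ρ ((j : ℝ) / (m + 1))) = ε m * (-1) ^ j * z 0 (ρ ((j : ℝ) / (m + 1))) ∧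
      z m (ρ ((j : ℝ) / (m + 1))) = ε m * (-1) ^ j *
        (f (ρ ((j : ℝ) / (m + 1))) * z 0 (ρ ((j : ℝ) / (m + 1))) - z 1 (ρ ((j : ℝ) / (m + 1)))) := by
    have hmem : ∀ m j : ℕ, 1 ≤ j → j ≤ m → (j : ℝ) / (m + 1) ∈ Ioo (0 : ℝ) 1 := by
      intro m j h1 h2
      have : (1 : ℝ) ≤ j := by exact_mod_cast h1
      have : (j : ℝ) ≤ m := by exact_mod_cast h2
      constructor
      · positivity
      · rw [div_lt_one (by positivity)]; linarith
    have hsin : ∀ t ∈ Ioo (0 : ℝ) 1, sin (t * π) ≠ 0 := fun t ht =>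
      (sin_pos_of_pos_of_lt_pi (by nlinarith [pi_pos, ht.1]) (by nlinarith [pi_pos, ht.2])).ne'
    rcases hρf with hf | hf
    · refine ⟨fun _ => 1, fun _ => Or.inl rfl, fun m j h1 h2 => ?_⟩
      have hm := hmem m j h1 h2
      have := h.node (hf _ hm) (hsin _ hm) (m := m) (j := j) (by field_simp)
      simpa using this
    -- When the trace increases on the band, the angle runs backwards and j becomes m + 1 - j. This
    -- changes the signs by a factor independent of j, which ε records.
    · refine ⟨fun m => (-1) ^ (m + 1), fun m => neg_one_pow_eq_or _ _, fun m j h1 h2 => ?_⟩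
      have hm := hmem m j h1 h2
      have hm' : 1 - (j : ℝ) / (m + 1) ∈ Ioo (0 : ℝ) 1 :=
        ⟨by linarith [hm.2], by linarith [hm.1]⟩
      have := h.node (hf _ hm) (hsin _ hm') (m := m) (j := m + 1 - j) (by
        rw [Nat.cast_sub (by lia)]; push_cast; field_simp)
      have hpow : (-1 : ℝ) ^ (m + 1 - j) = (-1) ^ (m + 1) * (-1) ^ j := by
        have e : m + 1 = (m + 1 - j) + j := by lia
        conv_rhs => rw [e]
        rw [pow_add, mul_assoc, ← mul_pow]; simp
      rw [hpow] at this
      exact this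
  obtain ⟨ε, hε, hnode⟩ := node
  have hεabs : ∀ m (j : ℕ) (x : ℝ), |ε m * (-1) ^ j * x| = |x| := by
    intro m j x
    rw [abs_mul, abs_mul, abs_pow, abs_neg, abs_one, one_pow, mul_one]
    rcases hε m with h | h <;> rw [h] <;> simp
  have hmem : ∀ m j : ℕ, j < m → ((j + 1 : ℕ) : ℝ) / (m + 1) ∈ Ioo (0 : ℝ) 1 := by
    intro m j h1
    have : (j : ℝ) + 1 ≤ m := by exact_mod_cast h1
    constructor
    · positivity
    · rw [div_lt_one (by positivity)]; push_cast; linarith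
  have hcast : ((M + 1 : ℕ) : ℝ) + 1 = M + 2 := by push_cast; ring
  -- The nodes have parameters (j+1)/(M+2) and (i+1)/(M+1), which interlace: (i+1)/(M+2) <
  -- (i+1)/(M+1) < (i+2)/(M+2).
  refine ⟨fun j => ρ (((j + 1 : ℕ) : ℝ) / ((M + 1 : ℕ) + 1)),
    fun i => ρ (((i + 1 : ℕ) : ℝ) / ((M : ℝ) + 1)),
    fun j => hρ _ (hmem _ _ j.2), fun i => hρ _ (hmem _ _ i.2), fun i => ⟨?_, ?_⟩,
    fun j => ?_, fun i => ?_, fun j => ?_, fun i => ?_⟩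
  · refine hρm (hmem _ _ (by simp)) (hmem _ _ i.2) ?_
    rw [hcast]
    simp only [Fin.val_castSucc]
    gcongr
    norm_num
  · refine hρm (hmem _ _ i.2) (hmem _ _ (by simp)) ?_
    have hi : ((i : ℕ) : ℝ) + 1 ≤ M := by exact_mod_cast i.2
    rw [hcast, div_lt_div_iff₀ (by positivity) (by positivity)]
    simp only [Fin.val_succ]
    push_cast
    nlinarith
  · rw [(hnode (M + 1) (j + 1) (by lia) (by lia)).1, hεabs]
    exact hz _ (Ioo_subset_Icc_self (hρ _ (hmem _ _ j.2)))
  · rw [(hnode M (i + 1) (by lia) (by lia)).1, hεabs]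
    exact hz _ (Ioo_subset_Icc_self (hρ _ (hmem _ _ i.2)))
  · rw [(hnode (M + 1) (j + 1) (by lia) (by lia)).2, hεabs]
    exact hy _ (Ioo_subset_Icc_self (hρ _ (hmem _ _ j.2)))
  · simp only [Fin.val_castSucc, Fin.val_succ]
    rw [(hnode (M + 1) (i + 1) (by lia) (by lia)).2,
      (hnode (M + 1) (i + 1 + 1) (by lia) (by lia)).2]
    have h3 := hsign _ (Ioo_subset_Icc_self (hρ _ (hmem (M + 1) i (by lia)))) _
      (Ioo_subset_Icc_self (hρ _ (hmem (M + 1) (i + 1) (by lia))))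
    have h4 : ε (M + 1) * ε (M + 1) = 1 := by rcases hε (M + 1) with h | h <;> rw [h] <;> norm_num
    have h5 : ((-1 : ℝ) ^ (i + 1 : ℕ)) * (-1) ^ (i + 1 + 1 : ℕ) = -1 := by
      rw [pow_succ (-1 : ℝ) (i + 1), ← mul_assoc, ← mul_pow]; simp
    have h6 : ∀ A B e s s' : ℝ, e * e = 1 → s * s' = -1 → 0 < A * B →
        e * s * A * (e * s' * B) < 0 := by
      intro A B e s s' h1 h2 h3
      have : e * s * A * (e * s' * B) = (e * e) * (s * s') * (A * B) := by ring
      rw [this, h1, h2]; linarith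
    exact h6 _ _ _ _ _ h4 h5 h3

/-- In a band on which the initial trace is at most `2`, all values in `[-2, 2]` are attained by
`z (M + 1)` at least `M` times. -/
theorem TraceSeq.le_ncard (h : TraceSeq V f z) (hV : 4 < V) {a b : ℝ} (hab : Crossing f a b)
    (hz : ∀ E ∈ Icc a b, |z 0 E| ≤ 2) {M : ℕ} {w : ℝ} (hw : w ∈ Icc (-2 : ℝ) 2)
    (hfin : {E | z (M + 1) E = w}.Finite) :
    M ≤ ({E | z (M + 1) E = w} ∩ Icc a b).ncard := by
  obtain ⟨P, Q, hP, -, hPQ, -, -, hP2, hPs⟩ := h.exists_nodes hV hab hz M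
  -- At consecutive nodes the values lie outside [-2, 2] on opposite sides, so w is attained in
  -- between.
  have hex : ∀ i : Fin M, ∃ x ∈ Icc (P i.castSucc) (P i.succ), z (M + 1) x = w := by
    intro i
    have hlt := (hPQ i).1.trans (hPQ i).2
    have hc : ContinuousOn (z (M + 1)) (Icc (P i.castSucc) (P i.succ)) := (h.cont _).continuousOn
    have h1 := hP2 i.castSucc
    have h2 := hP2 i.succ
    have h3 := hPs i
    rw [lt_abs] at h1 h2
    rcases h1 with h1 | h1 <;> rcases h2 with h2 | h2
    · nlinarith
    · exact intermediate_value_Icc' hlt.le hc ⟨by linarith [hw.1], by linarith [hw.2]⟩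
    · exact intermediate_value_Icc hlt.le hc ⟨by linarith [hw.1], by linarith [hw.2]⟩
    · nlinarith
  choose x hx hxw using hex
  have hne : ∀ i j, x i ≠ P j := by
    intro i j heq
    have h1 := hP2 j
    rw [← heq, hxw] at h1
    exact (abs_le.2 hw).not_gt h1
  have hPm : StrictMono P := Fin.strictMono_iff_lt_succ.2 fun i => (hPQ i).1.trans (hPQ i).2
  have hxm : StrictMono x := by
    intro i j hij
    have h1 : x i < P i.succ := (hx i).2.lt_of_ne (hne _ _)
    have h2 : P i.succ ≤ P j.castSucc := hPm.monotone (by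
      rw [Fin.le_def]; simp; exact hij)
    exact h1.trans_le (h2.trans (hx j).1)
  have hsub : range x ⊆ {E | z (M + 1) E = w} ∩ Icc a b := by
    rintro _ ⟨i, rfl⟩
    exact ⟨hxw i, (hP i.castSucc).1.le.trans (hx i).1, (hx i).2.trans (hP i.succ).2.le⟩
  have hcard : (range x).ncard = M := by
    rw [← Set.image_univ, ncard_image_of_injective _ hxm.injective, ncard_univ]
    simp
  refine hcard.symm.trans_le ?_
  exact ncard_le_ncard hsub (hfin.subset inter_subset_left)

end TraceSequences

end Sturmian

namespace Sturmian

/-! ### Counting solutions against the degree, by induction on the expansion -/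

section Counting

open Set

/-- The discriminant of `[0, 0, l]` as a function of the energy. -/
def trF (V : ℝ) (l : List ℤ) (E : ℝ) : ℝ := discr (0 :: 0 :: l) E V

/-- The discriminant of `[0, 0, l, m]` as a function of the energy. -/
def trD (V : ℝ) (l : List ℤ) (m : ℤ) (E : ℝ) : ℝ := discr (0 :: 0 :: (l ++ [m])) E V

/-- The period of `[0, 0, l]`. -/
def per (l : List ℤ) : ℕ := den (eval (0 :: 0 :: l))

theorem trF_append (V : ℝ) (l : List ℤ) (m : ℤ) : trF V (l ++ [m]) = trD V l m := rfl

theorem trD_append_zero (V : ℝ) (l : List ℤ) (m : ℤ) : trD V (l ++ [m]) 0 = trF V l := by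
  funext E; rw [trD, trF, discr, discr, eval_append_zero]

theorem trD_append_neg_one (V : ℝ) (l : List ℤ) (m : ℤ) :
    trD V (l ++ [m]) (-1) = trD V l (m - 1) := by
  funext E; rw [trD, trD, discr, discr, eval_append_neg_one]

theorem trD_append_one (V : ℝ) {l : List ℤ} (hl : ∀ d ∈ l, 1 ≤ d) {m : ℤ} (hm : 1 ≤ m) :
    trD V (l ++ [m]) 1 = trD V l (m + 1) := by
  funext E; rw [trD, trD, discr, discr, eval_append_one hl hm]

theorem append_pos {l : List ℤ} (hl : ∀ d ∈ l, 1 ≤ d) {m : ℤ} (hm : 1 ≤ m) :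
    ∀ d ∈ l ++ [m], 1 ≤ d := by
  intro d hd
  rcases List.mem_append.1 hd with h | h
  · exact hl d h
  · rw [List.mem_singleton.1 h]; exact hm

theorem continuous_trF (V : ℝ) (l : List ℤ) : Continuous (trF V l) :=
  (continuous_discr _).comp (continuous_id.prodMk continuous_const)

theorem continuous_trD (V : ℝ) (l : List ℤ) (m : ℤ) : Continuous (trD V l m) :=
  (continuous_discr _).comp (continuous_id.prodMk continuous_const)

variable {V : ℝ} {l : List ℤ} {α : ℕ}

theorem isMonicPoly_trF (V : ℝ) (hl : ∀ d ∈ l, 1 ≤ d) : IsMonicPoly (trF V l) (per l) :=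
  exists_poly_discr (one_le_den_eval hl) V

theorem traceSeq (V : ℝ) (hl : ∀ d ∈ l, 1 ≤ d) (T : BandType) :
    TraceSeq V (trF V l) fun m => trD V l (m + T.digit) := by
  refine ⟨continuous_trF V l, fun m => continuous_trD V l _, fun m E => ?_, fun E => ?_⟩
  · have hm : 0 ≤ (m : ℤ) + 1 + T.digit := by cases T <;> simp [BandType.digit]; lia
    have := discr_succ hl hm E V
    simp only [trD, trF]
    convert this using 4 <;> push_cast <;> ring_nf
  · cases T
    · have := discr_invariant hl 1 E V
      simp only [trD, trF, BandType.digit]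
      simp at this ⊢
      linear_combination this
    · have := discr_invariant hl 0 E V
      simp only [trD, trF, BandType.digit]
      simp at this ⊢
      linear_combination this

/-- The sequences start at the predecessor `[c, T.digit]`; the term of index M + 1 is then the trace
of `[c, m]`. -/
theorem count_add_digit (T : BandType) {m : ℕ} (hm : 1 ≤ m) :
    ((T.count m + 1 : ℕ) : ℤ) + T.digit = m := by
  cases T <;> simp [BandType.count, BandType.digit]; lia

/-- Counting statement for the bands of a discriminant. -/
structure Core (V : ℝ) (l : List ℤ) (α : ℕ) : Prop where
  hyp : Hyp (trF V l) (per l)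
  cover : ∀ E, |trF V l E| ≤ 2 → |trD V l 0 E| ≤ 2 ∨ |trD V l (-1) E| ≤ 2
  card : ∀ w ∈ Icc (-2 : ℝ) 2, {E | trF V l E = w ∧ |trD V l 0 E| ≤ 2}.ncard = α

theorem not_both (hV : 4 < V) (hl : ∀ d ∈ l, 1 ≤ d) {E : ℝ} (h : |trF V l E| ≤ 2)
    (h0 : |trD V l 0 E| ≤ 2) (h1 : |trD V l (-1) E| ≤ 2) : False := by
  have := (traceSeq V hl .B).excl hV (m := 0) h (by simpa [BandType.digit] using h1)
  simp [BandType.digit] at this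
  exact this.not_ge h0

/-- Each band lies in the stable set of one of the two predecessors. -/
theorem exists_type (hV : 4 < V) (hl : ∀ d ∈ l, 1 ≤ d)
    (hcov : ∀ E, |trF V l E| ≤ 2 → |trD V l 0 E| ≤ 2 ∨ |trD V l (-1) E| ≤ 2) {S : Set ℝ}
    (hS : IsPreconnected S) (hsub : S ⊆ stable (trF V l)) :
    ∃ T : BandType, ∀ E ∈ S, |trD V l T.digit E| ≤ 2 := by
  have hc : ∀ k, IsClosed (stable (trD V l k)) := fun k =>
    isClosed_Icc.preimage (continuous_trD V l k)
  -- The two conditions are closed, cover S, and exclude each other on the stable set by the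
  -- invariant.
  have := isPreconnected_iff_subset_of_disjoint_closed.1 hS _ _ (hc 0) (hc (-1))
    (fun E hE => by
      rcases hcov E (mem_stable.1 (hsub hE)) with h | h
      · exact Or.inl (mem_stable.2 h)
      · exact Or.inr (mem_stable.2 h))
    (eq_empty_of_forall_notMem fun E hE => not_both hV hl (mem_stable.1 (hsub hE.1))
      (mem_stable.1 hE.2.1) (mem_stable.1 hE.2.2))
  rcases this with h | h
  · exact ⟨.A, fun E hE => mem_stable.1 (h hE)⟩
  · exact ⟨.B, fun E hE => mem_stable.1 (h hE)⟩

theorem count_le_ncard (hV : 4 < V) (hl : ∀ d ∈ l, 1 ≤ d) {a b : ℝ}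
    (hab : Crossing (trF V l) a b) {T : BandType} (hT : ∀ E ∈ Icc a b, |trD V l T.digit E| ≤ 2)
    {m : ℕ} (hm : 1 ≤ m) {w : ℝ} (hw : w ∈ Icc (-2 : ℝ) 2) :
    T.count m ≤ ({E | trD V l m E = w} ∩ Icc a b).ncard := by
  have hl' := append_pos hl (m := m) (by exact_mod_cast hm)
  have hfin := (isMonicPoly_trF V hl').finite (one_le_den_eval hl') w
  rw [trF_append] at hfin
  have := (traceSeq V hl T).le_ncard hV hab (M := T.count m) (by simpa using hT) hw
    (by rw [count_add_digit T hm]; exact hfin)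
  rw [count_add_digit T hm] at this
  exact this

/-- Every band holds exactly one zero of the trace and lies wholly over one predecessor, so α, read
off at w = 0, is the number of bands of type A. -/
theorem Core.sum_count (h : Core V l α) (hV : 4 < V) (hl : ∀ d ∈ l, 1 ≤ d)
    {e a b : Fin (per l) → ℝ} (hb : BandSystem (trF V l) (per l) e a b)
    {τ : Fin (per l) → BandType}
    (hτ : ∀ i, ∀ E ∈ Icc (a i) (b i), |trD V l (τ i).digit E| ≤ 2) :
    α ≤ per l ∧ ∀ m, ∑ i, (τ i).count m = α * (m - 1) + (per l - α) * m := by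
  classical
  have hα : (Finset.univ.filter fun i => τ i = .A).card = α := by
    rw [← h.card 0 (by norm_num)]
    have : {E | trF V l E = 0 ∧ |trD V l 0 E| ≤ 2} =
        e '' ((Finset.univ.filter fun i => τ i = .A : Finset _) : Set (Fin (per l))) := by
      ext E
      simp only [mem_ofPred_eq, mem_image, Finset.coe_filter, Finset.mem_univ, true_and]
      constructor
      · rintro ⟨h0, h1⟩
        have hE : |trF V l E| ≤ 2 := by rw [h0]; norm_num
        obtain ⟨i, hi⟩ := hb.cover E (mem_stable.2 hE)
        refine ⟨i, ?_, ?_⟩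
        · cases hti : τ i
          · rfl
          · exfalso
            have := hτ i E hi
            rw [hti] at this
            exact not_both hV hl hE h1 this
        · exact (hb.crossing i).injOn (Ioo_subset_Icc_self (hb.mem i)) hi
            ((hb.zero i).trans h0.symm)
      · rintro ⟨i, hi, rfl⟩
        refine ⟨hb.zero i, ?_⟩
        have := hτ i _ (Ioo_subset_Icc_self (hb.mem i))
        rwa [hi] at this
    rw [this, ncard_image_of_injective _ hb.strictMono.injective, ncard_coe_finset]
  have hcompl := Finset.card_filter_add_card_filter_not (s := (Finset.univ : Finset (Fin (per l))))
    (fun i => τ i = .A)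
  rw [hα, Finset.card_univ, Fintype.card_fin] at hcompl
  refine ⟨by lia, fun m => ?_⟩
  rw [← Finset.sum_filter_add_sum_filter_not _ (fun i => τ i = .A),
    Finset.sum_congr rfl (g := fun _ => m - 1), Finset.sum_congr (s₁ := Finset.univ.filter
      fun i => ¬ τ i = .A) rfl (g := fun _ => m)]
  · rw [Finset.sum_const, Finset.sum_const, hα, smul_eq_mul, smul_eq_mul]
    congr 2
    lia
  · intro i hi
    have := (Finset.mem_filter.1 hi).2
    cases hti : τ i
    · exact absurd hti this
    · rfl
  · intro i hi
    rw [(Finset.mem_filter.1 hi).2]; rfl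

theorem Core.exists_system (h : Core V l α) (hV : 4 < V) (hl : ∀ d ∈ l, 1 ≤ d) :
    ∃ (e a b : Fin (per l) → ℝ) (τ : Fin (per l) → BandType),
      BandSystem (trF V l) (per l) e a b ∧
      ∀ i, ∀ E ∈ Icc (a i) (b i), |trD V l (τ i).digit E| ≤ 2 := by
  obtain ⟨e, a, b, hb⟩ := h.hyp.exists_bandSystem
  choose τ hτ using fun i => exists_type hV hl h.cover isPreconnected_Icc (hb.crossing i).subset
  exact ⟨e, a, b, τ, hb, hτ⟩

theorem Core.le_per (h : Core V l α) (hV : 4 < V) (hl : ∀ d ∈ l, 1 ≤ d) : α ≤ per l := by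
  obtain ⟨e, a, b, τ, hb, hτ⟩ := h.exists_system hV hl
  exact (h.sum_count hV hl hb hτ).1

theorem finite_trD (V : ℝ) (hl : ∀ d ∈ l, 1 ≤ d) {m : ℕ} (hm : 1 ≤ m) (w : ℝ) :
    {E | trD V l m E = w}.Finite := by
  have hl' := append_pos hl (m := m) (by exact_mod_cast hm)
  exact (isMonicPoly_trF V hl').finite (one_le_den_eval hl') w

theorem setOf_and_stable (f g : ℝ → ℝ) (w : ℝ) :
    {E | f E = w ∧ |g E| ≤ 2} = {E | f E = w} ∩ stable g := by
  ext E; simp [mem_stable]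

theorem Core.lower (h : Core V l α) (hV : 4 < V) (hl : ∀ d ∈ l, 1 ≤ d) {m : ℕ} (hm : 1 ≤ m)
    {w : ℝ} (hw : w ∈ Icc (-2 : ℝ) 2) :
    α * (m - 1) + (per l - α) * m ≤ {E | trD V l m E = w ∧ |trF V l E| ≤ 2}.ncard := by
  obtain ⟨e, a, b, τ, hb, hτ⟩ := h.exists_system hV hl
  rw [← (h.sum_count hV hl hb hτ).2 m, setOf_and_stable, hb.ncard_inter (finite_trD V hl hm w)]
  exact Finset.sum_le_sum fun i _ => count_le_ncard hV hl (hb.crossing i) (hτ i) hm hw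

/-- If enough solutions lie over the two predecessors, these are all solutions. -/
theorem core_of_lower (hV : 4 < V) (hl : ∀ d ∈ l, 1 ≤ d) {m : ℕ} (hm : 1 ≤ m) {x y : ℕ}
    (hx : ∀ w ∈ Icc (-2 : ℝ) 2, x ≤ {E | trD V l m E = w ∧ |trF V l E| ≤ 2}.ncard)
    (hy : ∀ w ∈ Icc (-2 : ℝ) 2, y ≤ {E | trD V l m E = w ∧ |trD V l (m - 1) E| ≤ 2}.ncard)
    (hxy : x + y = per (l ++ [(m : ℤ)])) : Core V (l ++ [(m : ℤ)]) x := by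
  have hm' : (1 : ℤ) ≤ m := by exact_mod_cast hm
  have hl' := append_pos hl hm'
  have hpoly := isMonicPoly_trF V hl'
  have hpos : 1 ≤ per (l ++ [(m : ℤ)]) := one_le_den_eval hl'
  have hfin := fun w => hpoly.finite hpos w
  have hup := fun w => hpoly.ncard_le hpos w
  simp only [trF_append] at hfin hup
  -- The traces of `[c, m]`, `c` and `[c, m - 1]` are never all in [-2, 2].
  have hdisj : ∀ w ∈ Icc (-2 : ℝ) 2, Disjoint {E | trD V l m E = w ∧ |trF V l E| ≤ 2}
      {E | trD V l m E = w ∧ |trD V l (m - 1) E| ≤ 2} := by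
    intro w hw
    refine disjoint_left.2 fun E h1 h2 => ?_
    refine not_both hV hl' (E := E) ?_ ?_ ?_
    · rw [trF_append, h1.1]; exact abs_le.2 hw
    · rw [trD_append_zero]; exact h1.2
    · rw [trD_append_neg_one]; exact h2.2
  have hunion : ∀ w ∈ Icc (-2 : ℝ) 2, ({E | trD V l m E = w ∧ |trF V l E| ≤ 2} ∪
      {E | trD V l m E = w ∧ |trD V l (m - 1) E| ≤ 2}).ncard =
      {E | trD V l m E = w ∧ |trF V l E| ≤ 2}.ncard +
      {E | trD V l m E = w ∧ |trD V l (m - 1) E| ≤ 2}.ncard := fun w hw =>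
    ncard_union_eq (hdisj w hw) ((hfin w).subset fun E hE => hE.1)
      ((hfin w).subset fun E hE => hE.1)
  have hsub : ∀ w, ({E | trD V l m E = w ∧ |trF V l E| ≤ 2} ∪
      {E | trD V l m E = w ∧ |trD V l (m - 1) E| ≤ 2}) ⊆ {E | trD V l m E = w} :=
    fun w => union_subset (fun E hE => hE.1) fun E hE => hE.1
  have hle := fun w => ncard_le_ncard (hsub w) (hfin w)
  refine ⟨⟨hpoly, hpos, fun w hw => ?_⟩, fun E hE => ?_, fun w hw => ?_⟩
  · have h1 := hx w hw
    have h2 := hy w hw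
    have h3 := hunion w hw
    have h4 := hle w
    rw [trF_append]
    lia
  · rw [trF_append] at hE
    have hw : trD V l m E ∈ Icc (-2 : ℝ) 2 := abs_le.1 hE
    have h1 := hx _ hw
    have h2 := hy _ hw
    have h3 := hunion _ hw
    -- The x + y solutions found fill the degree. With w the value at E itself, E must be one of
    -- them, so it lies over a predecessor.
    have heq := eq_of_subset_of_ncard_le (hsub (trD V l m E)) (by
      have := hup (trD V l m E); lia) (hfin _)
    have hmem : E ∈ {E' | trD V l m E' = trD V l m E} := rfl
    rw [← heq] at hmem
    rw [trD_append_zero, trD_append_neg_one]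
    exact hmem.imp And.right And.right
  · have h1 := hx w hw
    have h2 := hy w hw
    have h3 := hunion w hw
    have h4 := hle w
    have h5 := hup w
    rw [trF_append, trD_append_zero]
    lia

/-- The inductive statement on the bands of the discriminants. -/
structure Full (V : ℝ) (l : List ℤ) (α : ℕ) : Prop extends Core V l α where
  next : ∀ w ∈ Icc (-2 : ℝ) 2, α + per (l ++ [0]) ≤ {E | trD V l 1 E = w ∧ |trD V l 0 E| ≤ 2}.ncard
  strict : ∀ (T : BandType) E, |trF V l E| ≤ 2 → |trD V l T.digit E| ≤ 2 →
    |trD V l T.digit E| < 2 ∨ ∀ E', trD V l T.digit E' = 2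
  strict_next : ∀ E, |trD V l 1 E| ≤ 2 → |trD V l 0 E| ≤ 2 →
    |trD V l 0 E| < 2 ∨ ∀ E', trD V l 0 E' = 2

/-- At the edges of the bands all successors are unstable. -/
theorem Core.edge (h : Core V l α) (hV : 4 < V) (hl : ∀ d ∈ l, 1 ≤ d) {E : ℝ}
    (hE : |trF V l E| = 2) {m : ℕ} (hm : 1 ≤ m) : 2 < |trD V l m E| := by
  have key : ∀ T : BandType, |trD V l T.digit E| ≤ 2 → 2 < |trD V l m E| := by
    intro T hT
    have := (traceSeq V hl T).edge hV hE (by simpa using hT) (T.count m)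
    rwa [count_add_digit T hm] at this
  rcases h.cover E hE.le with h | h
  · exact key .A h
  · exact key .B h

/-- Solutions over `c` come from `Core.lower`. Those over the preceding digit come from `next` when
m = 1. In the step to m + 1, `[c, m + 1] = [c, m, 1]` and each type B band of `[c, m]` contributes
at least one; there are α + q' of these, with q' the denominator of `[c, 0]`. -/
theorem Full.core_append (h : Full V l α) (hV : 4 < V) (hl : ∀ d ∈ l, 1 ≤ d) {m : ℕ}
    (hm : 1 ≤ m) : Core V (l ++ [(m : ℤ)]) (α * (m - 1) + (per l - α) * m) := by
  have hα := h.le_per hV hl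
  have hper : ∀ m : ℕ, per (l ++ [(m : ℤ)]) = m * per l + per (l ++ [0]) := fun m =>
    den_eval_append hl
  have hsum : ∀ m : ℕ, 1 ≤ m →
      α * (m - 1) + (per l - α) * m + (α + per (l ++ [0])) = per (l ++ [(m : ℤ)]) := by
    intro m hm
    obtain ⟨m, rfl⟩ := Nat.exists_eq_add_of_le' hm
    obtain ⟨β, hβ⟩ := Nat.exists_eq_add_of_le hα
    rw [hper, hβ]
    simp only [Nat.add_sub_cancel, Nat.add_sub_cancel_left]
    ring
  induction m, hm using Nat.le_induction with
  | base =>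
    refine core_of_lower hV hl le_rfl (fun w hw => h.lower hV hl le_rfl hw) (fun w hw => ?_)
      (hsum 1 le_rfl)
    simpa using h.next w hw
  | succ m hm ih =>
    have hm' : (1 : ℤ) ≤ m := by exact_mod_cast hm
    refine core_of_lower hV hl (by lia) (fun w hw => h.lower hV hl (by lia) hw) (fun w hw => ?_)
      (hsum (m + 1) (by lia))
    have h1 := ih.lower hV (append_pos hl hm') le_rfl hw
    rw [Nat.cast_one, trD_append_one V hl hm', trF_append] at h1
    rw [Nat.cast_succ, add_sub_cancel_right]
    refine le_trans ?_ h1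
    have := hsum m hm
    lia

/-- Strictness says that a stable successor never meets an edge of its predecessor, which is
`Core.edge`. The type B predecessor of `[c, m]` is `[c, m - 1]`: for m ≥ 2, `[c, m]` is its
successor `[c, m - 1, 1]`; for m = 1 it is `[c, 0]`, for which `strict_next` is carried along. -/
theorem Full.append (h : Full V l α) (hV : 4 < V) (hl : ∀ d ∈ l, 1 ≤ d) {m : ℕ}
    (hm : 1 ≤ m) : Full V (l ++ [(m : ℤ)]) (α * (m - 1) + (per l - α) * m) := by
  have hm' : (1 : ℤ) ≤ m := by exact_mod_cast hm
  have hα := h.le_per hV hl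
  have hlt : ∀ k : ℕ, 1 ≤ k → ∀ E, |trD V l k E| ≤ 2 → |trF V l E| ≤ 2 → |trF V l E| < 2 :=
    fun k hk E h1 h2 => h2.lt_of_ne fun heq => (h.edge hV hl heq hk).not_ge h1
  refine ⟨h.core_append hV hl hm, fun w hw => ?_, fun T E h1 h2 => ?_, fun E h1 h2 => ?_⟩
  · have h1 := h.lower hV hl (m := m + 1) (by lia) hw
    rw [trD_append_one V hl hm', trD_append_zero]
    have h2 : per (l ++ [(m : ℤ)] ++ [0]) = per l := by rw [per, per, eval_append_zero]
    rw [h2]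
    rw [Nat.cast_succ] at h1
    refine le_trans (le_of_eq ?_) h1
    obtain ⟨m, rfl⟩ := Nat.exists_eq_add_of_le' hm
    obtain ⟨β, hβ⟩ := Nat.exists_eq_add_of_le hα
    rw [hβ]
    simp only [Nat.add_sub_cancel, Nat.add_sub_cancel_left]
    ring
  · cases T
    · simp only [BandType.digit, trD_append_zero] at h2 ⊢
      exact Or.inl (hlt m hm E h1 h2)
    · simp only [BandType.digit, trD_append_neg_one] at h2 ⊢
      rcases hm.eq_or_lt with rfl | hm1
      · simp only [Nat.cast_one, sub_self] at h2 ⊢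
        exact h.strict_next E (by simpa [trF_append] using h1) h2
      · obtain ⟨k, rfl⟩ := Nat.exists_eq_add_of_le' hm
        have hk : 1 ≤ k := by lia
        have hk' : (1 : ℤ) ≤ k := by exact_mod_cast hk
        rw [Nat.cast_succ, add_sub_cancel_right] at h2 ⊢
        refine Or.inl (h2.lt_of_ne fun heq => ?_)
        have := (h.core_append hV hl hk).edge hV (append_pos hl hk') heq le_rfl
        rw [Nat.cast_one, trD_append_one V hl hk'] at this
        rw [Nat.cast_succ, trF_append] at h1
        exact this.not_ge h1
  · rw [trD_append_zero] at h2 ⊢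
    rw [trD_append_one V hl hm'] at h1
    exact Or.inl (hlt (m + 1) (by lia) E (by exact_mod_cast h1) h2)

/-- The traces of `[0, 0]`, `[0, 0, 0]`, `[0, 0, -1]` are E, 2 and E + V. The single band has type A
over the whole line; the constant trace 2 is why strictness has an alternative. Type B would need E
≥ -2 and E + V ≤ 2, against V > 4. -/
theorem full_nil (hV : 4 < V) : Full V [] 1 := by
  have hF : ∀ E, trF V [] E = E := fun E => discr_nil E V
  have h0 : ∀ E, trD V [] 0 E = 2 := fun E => discr_zero E V
  have hm : ∀ E, trD V [] (-1) E = E + V := fun E => discr_neg_one E V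
  have hnil : ∀ d ∈ ([] : List ℤ), 1 ≤ d := by simp
  have h1 : ∀ E, trD V [] 1 E = E - V := fun E => by
    have := discr_succ hnil le_rfl E V (m := 0)
    simp only [zero_add, zero_sub, List.nil_append] at this
    rw [trD, List.nil_append, this, discr_nil, discr_zero, discr_neg_one]
    ring
  have hp : per [] = 1 := by
    have : (den (eval [0, 0]) : ℤ) = 1 := by simpa [cfm_nil] using den_eval hnil
    exact_mod_cast this
  have hp0 : per [0] = 0 := by
    have : eval [0, 0, 0] = toPt 1 0 := by simp [eval, evalRev, toPt]
    rw [per, this, toPt, if_pos rfl]; rfl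
  refine ⟨⟨⟨isMonicPoly_trF V hnil, hp.ge, fun w _ => ?_⟩, fun E _ => Or.inl ?_, fun w _ => ?_⟩,
    fun w _ => ?_, fun T E hE hE' => ?_, fun E _ _ => Or.inr h0⟩
  · have : {E | trF V [] E = w} = {w} := by ext E; simp [hF]
    rw [this, ncard_singleton, hp]
  · rw [h0]; norm_num
  · have : {E | trF V [] E = w ∧ |trD V [] 0 E| ≤ 2} = {w} := by ext E; simp [hF, h0]
    rw [this, ncard_singleton]
  · have : {E | trD V [] 1 E = w ∧ |trD V [] 0 E| ≤ 2} = {w + V} := by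
      ext E; simp [h1, h0, sub_eq_iff_eq_add]
    rw [this, ncard_singleton, List.nil_append, hp0]
  · cases T
    · exact Or.inr h0
    · exfalso
      simp only [BandType.digit] at hE'
      rw [hF] at hE
      rw [hm] at hE'
      have := (abs_le.1 hE).1
      have := (abs_le.1 hE').2
      linarith

theorem exists_full (hV : 4 < V) (hl : ∀ d ∈ l, 1 ≤ d) : ∃ α, Full V l α := by
  induction l using List.reverseRecOn with
  | nil => exact ⟨1, full_nil hV⟩
  | append_singleton l k ih =>
    have hk : 1 ≤ k := hl k (by simp)
    have hl' : ∀ d ∈ l, 1 ≤ d := fun d hd => hl d (by simp [hd])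
    obtain ⟨α, h⟩ := ih hl'
    lift k to ℕ using by lia
    exact ⟨_, h.append hV hl' (by exact_mod_cast hk)⟩

/-- The number of solutions in a band is given by its type. -/
theorem Full.ncard_inter (h : Full V l α) (hV : 4 < V) (hl : ∀ d ∈ l, 1 ≤ d)
    {e a b : Fin (per l) → ℝ} (hb : BandSystem (trF V l) (per l) e a b)
    {τ : Fin (per l) → BandType}
    (hτ : ∀ i, ∀ E ∈ Icc (a i) (b i), |trD V l (τ i).digit E| ≤ 2) (i : Fin (per l)) {m : ℕ}
    (hm : 1 ≤ m) {w : ℝ} (hw : w ∈ Icc (-2 : ℝ) 2) :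
    ({E | trD V l m E = w} ∩ Icc (a i) (b i)).ncard = (τ i).count m := by
  have h1 := (h.core_append hV hl hm).card w hw
  rw [trF_append, trD_append_zero, setOf_and_stable, hb.ncard_inter (finite_trD V hl hm w),
    ← (h.sum_count hV hl hb hτ).2 m] at h1
  -- The band by band lower bounds have a sum equal to the exact total, so each of them is an
  -- equality.
  exact ((Finset.sum_eq_sum_iff_of_le fun i _ =>
    count_le_ncard hV hl (hb.crossing i) (hτ i) hm hw).1 h1.symm i (Finset.mem_univ i)).symm

end Counting

end Sturmian

namespace Sturmian

/-! ### Sub-bands, backward types and forward families -/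

section Subbands

open Set Topology

variable {V : ℝ} {l : List ℤ}

theorem isBand_congr {c c' : List ℤ} (h : eval c = eval c') (V : ℝ) (I : Set ℝ) :
    IsBand c V I ↔ IsBand c' V I := by
  have : spec c V = spec c' V := by
    ext E; simp only [spec, discr, h]
  rw [IsBand, IsBand, this]

theorem IsBand.nonempty {c : List ℤ} {I : Set ℝ} (h : IsBand c V I) : I.Nonempty := by
  obtain ⟨E, hE, rfl⟩ := h
  exact ⟨E, mem_connectedComponentIn hE⟩

theorem IsBand.subset {c : List ℤ} {I : Set ℝ} (h : IsBand c V I) : I ⊆ spec c V := by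
  obtain ⟨E, hE, rfl⟩ := h
  exact connectedComponentIn_subset _ _

theorem IsBand.isPreconnected {c : List ℤ} {I : Set ℝ} (h : IsBand c V I) : IsPreconnected I := by
  obtain ⟨E, hE, rfl⟩ := h
  exact isPreconnected_connectedComponentIn

theorem IsBand.eq {c : List ℤ} {I : Set ℝ} (h : IsBand c V I) {E : ℝ} (hE : E ∈ I) :
    I = connectedComponentIn (spec c V) E := by
  obtain ⟨E', hE', rfl⟩ := h
  exact connectedComponentIn_eq hE

theorem IsBand.eq_of_mem {c : List ℤ} {I J : Set ℝ} (hI : IsBand c V I) (hJ : IsBand c V J)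
    {E : ℝ} (h1 : E ∈ I) (h2 : E ∈ J) : I = J :=
  (hI.eq h1).trans (hJ.eq h2).symm

theorem IsBand.subset_of_mem {c : List ℤ} {J S : Set ℝ} (hJ : IsBand c V J)
    (hS : IsPreconnected S) (hsub : S ⊆ spec c V) {E : ℝ} (h1 : E ∈ S) (h2 : E ∈ J) : S ⊆ J := by
  rw [hJ.eq h2]
  exact hS.subset_connectedComponentIn h1 hsub

theorem isBand_of_mem {c : List ℤ} {E : ℝ} (hE : E ∈ spec c V) :
    IsBand c V (connectedComponentIn (spec c V) E) := ⟨E, hE, rfl⟩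

theorem IsBand.exists_crossing (hV : 4 < V) (hl : ∀ d ∈ l, 1 ≤ d) {I : Set ℝ}
    (h : IsBand (0 :: 0 :: l) V I) : ∃ a b, Crossing (trF V l) a b ∧ I = Icc a b := by
  obtain ⟨α, hα⟩ := exists_full hV hl
  obtain ⟨E, hE, rfl⟩ := h
  obtain ⟨a, b, h1, -, h2⟩ := hα.hyp.component hE
  exact ⟨a, b, h1, h2⟩

theorem StrictLeftOf.leftOf {a b c d : ℝ} (hab : a < b) (hcd : c < d)
    (h : StrictLeftOf (Icc a b) (Icc c d)) : LeftOf (Icc a b) (Icc c d) := by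
  have hbc := h b (right_mem_Icc.2 hab.le) c (left_mem_Icc.2 hcd.le)
  rw [LeftOf, csInf_Icc hab.le, csInf_Icc hcd.le, csSup_Icc hab.le, csSup_Icc hcd.le]
  constructor <;> linarith

/-- The band `I` lies over the predecessor of type `T`. -/
def Over (V : ℝ) (l : List ℤ) (T : BandType) (I : Set ℝ) : Prop :=
  ∀ E ∈ I, |trD V l T.digit E| ≤ 2

theorem IsBand.exists_over (hV : 4 < V) (hl : ∀ d ∈ l, 1 ≤ d) {I : Set ℝ}
    (h : IsBand (0 :: 0 :: l) V I) : ∃ T, Over V l T I := by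
  obtain ⟨α, hα⟩ := exists_full hV hl
  exact exists_type hV hl hα.cover h.isPreconnected h.subset

theorem Over.unique (hV : 4 < V) (hl : ∀ d ∈ l, 1 ≤ d) {I : Set ℝ} {E : ℝ} (hE : E ∈ I)
    (hI : I ⊆ spec (0 :: 0 :: l) V) {T T' : BandType} (h : Over V l T I)
    (h' : |trD V l T'.digit E| ≤ 2) : T = T' := by
  have hF : |trF V l E| ≤ 2 := mem_stable.1 (hI hE)
  have := h E hE
  cases T <;> cases T'
  · rfl
  · exact (not_both hV hl hF this h').elim
  · exact (not_both hV hl hF h' this).elim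
  · rfl

theorem WeakBackward.over {T : BandType} {I : Set ℝ}
    (h : WeakBackward T (0 :: 0 :: l) V I) : Over V l T I := by
  obtain ⟨J, hJ, hIJ⟩ := h
  exact fun E hE => mem_stable.1 (hJ.subset (hIJ hE))

theorem Backward.over {T : BandType} {I : Set ℝ}
    (h : Backward T (0 :: 0 :: l) V I) : Over V l T I := by
  obtain ⟨J, hJ, hIJ⟩ := h
  exact WeakBackward.over ⟨J, hJ, hIJ.trans interior_subset⟩

/-- Since the predecessor is strictly inside (-2, 2) on I, a ball around each point of I stays in
the same predecessor band. If the predecessor is constantly 2, its only band is the line. -/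
theorem Over.backward (hV : 4 < V) (hl : ∀ d ∈ l, 1 ≤ d) {I : Set ℝ}
    (hI : IsBand (0 :: 0 :: l) V I) {T : BandType} (h : Over V l T I) :
    Backward T (0 :: 0 :: l) V I := by
  obtain ⟨α, hα⟩ := exists_full hV hl
  have hstr := fun E hE => hα.strict T E (mem_stable.1 (hI.subset hE)) (h E hE)
  have hspec : spec (0 :: 0 :: l ++ [T.digit]) V = stable (trD V l T.digit) := rfl
  by_cases hconst : ∀ E', trD V l T.digit E' = 2
  · have huniv : spec (0 :: 0 :: l ++ [T.digit]) V = univ := by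
      rw [hspec]
      refine eq_univ_of_forall fun E => mem_stable.2 ?_
      rw [hconst]; norm_num
    refine ⟨univ, ⟨0, huniv ▸ mem_univ _, ?_⟩, ?_⟩
    · rw [huniv]
      rw [connectedComponentIn_univ, PreconnectedSpace.connectedComponent_eq_univ]
    · rw [StrictIncl, interior_univ]; exact subset_univ _
  · obtain ⟨E₀, hE₀⟩ := hI.nonempty
    have hsub : I ⊆ spec (0 :: 0 :: l ++ [T.digit]) V := fun E hE => mem_stable.2 (h E hE)
    have hJ := isBand_of_mem (hsub hE₀)
    refine ⟨_, hJ, fun E hE => ?_⟩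
    have hEJ := hJ.subset_of_mem hI.isPreconnected hsub hE₀ (mem_connectedComponentIn (hsub hE₀)) hE
    have hlt : |trD V l T.digit E| < 2 := (hstr E hE).resolve_right hconst
    have hev : ∀ᶠ x in 𝓝 E, |trD V l T.digit x| < 2 :=
      (continuous_trD V l _).abs.continuousAt.eventually_lt_const hlt
    obtain ⟨ε, hε, hball⟩ := Metric.eventually_nhds_iff_ball.1 hev
    refine mem_interior.2 ⟨Metric.ball E ε, ?_, Metric.isOpen_ball, Metric.mem_ball_self hε⟩
    exact hJ.subset_of_mem (convex_ball E ε).isPreconnected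
      (fun x hx => mem_stable.2 (hball x hx).le) (Metric.mem_ball_self hε) hEJ

theorem IsBand.ncard_inter (hV : 4 < V) (hl : ∀ d ∈ l, 1 ≤ d) {I : Set ℝ}
    (hI : IsBand (0 :: 0 :: l) V I) {T : BandType} (h : Over V l T I) {m : ℕ} (hm : 1 ≤ m) :
    ({E | trD V l m E = 0} ∩ I).ncard = T.count m := by
  obtain ⟨α, hα⟩ := exists_full hV hl
  obtain ⟨e, a, b, τ, hb, hτ⟩ := hα.exists_system hV hl
  obtain ⟨E, hE⟩ := hI.nonempty
  obtain ⟨i, hi⟩ := hb.cover E (hI.subset hE)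
  have hIi : I = Icc (a i) (b i) := (hI.eq hE).trans (hb.comp i E hi)
  have hT : T = τ i := h.unique hV hl hE hI.subset (hτ i E hi)
  rw [hIi, hT]
  exact hα.ncard_inter hV hl hb hτ i hm (by norm_num)

/-- Distinct sub-bands, as many as the type allows, are all the sub-bands. -/
theorem IsBand.exists_eq (hV : 4 < V) (hl : ∀ d ∈ l, 1 ≤ d) {I : Set ℝ}
    (hI : IsBand (0 :: 0 :: l) V I) {T : BandType} (h : Over V l T I) {m : ℕ} (hm : 1 ≤ m)
    {N : ℕ} (hN : N = T.count m) {J : Fin N → Set ℝ}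
    (hJ : ∀ i, IsBand (0 :: 0 :: (l ++ [(m : ℤ)])) V (J i)) (hJI : ∀ i, J i ⊆ I)
    (hinj : Function.Injective J) {L : Set ℝ} (hL : IsBand (0 :: 0 :: (l ++ [(m : ℤ)])) V L)
    (hLI : L ⊆ I) : ∃ i, J i = L := by
  have hl' := append_pos hl (m := m) (by exact_mod_cast hm)
  -- Zeros stand for bands: the N distinct bands use up all `T.count m` zeros in I, so the zero of L
  -- belongs to one of them.
  have hzero : ∀ {L : Set ℝ}, IsBand (0 :: 0 :: (l ++ [(m : ℤ)])) V L →
      ∃ x ∈ L, trD V l m x = 0 := by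
    intro L hL
    obtain ⟨a, b, hab, rfl⟩ := hL.exists_crossing hV hl'
    exact hab.surj (w := 0) (by norm_num)
  choose x hx hx0 using fun i => hzero (hJ i)
  have hxinj : Function.Injective x := fun i j hij =>
    hinj ((hJ i).eq_of_mem (hJ j) (hx i) (hij ▸ hx j))
  have hrange : range x = {E | trD V l m E = 0} ∩ I := by
    refine eq_of_subset_of_ncard_le ?_ ?_ ((finite_trD V hl hm 0).subset inter_subset_left)
    · rintro _ ⟨i, rfl⟩
      exact ⟨hx0 i, hJI i (hx i)⟩
    · rw [hI.ncard_inter hV hl h hm, ← hN, ← Set.image_univ,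
        ncard_image_of_injective _ hxinj, ncard_univ]
      simp
  obtain ⟨y, hy, hy0⟩ := hzero hL
  have : y ∈ range x := hrange ▸ ⟨hy0, hLI hy⟩
  obtain ⟨i, rfl⟩ := this
  exact ⟨i, (hJ i).eq_of_mem hL (hx i) hy⟩

theorem strictLeftOf_of_disjoint {A B : Set ℝ} (hA : IsPreconnected A) (hB : IsPreconnected B)
    (hAB : Disjoint A B) {x y : ℝ} (hx : x ∈ A) (hy : y ∈ B) (hxy : x < y) : StrictLeftOf A B := by
  intro a ha b hb
  by_contra hba
  rw [not_lt] at hba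
  rcases le_total b x with h | h
  · exact disjoint_left.1 hAB hx (hB.Icc_subset hb hy ⟨h, hxy.le⟩)
  · exact disjoint_left.1 hAB (hA.Icc_subset hx ha ⟨h, hba⟩) hb

theorem StrictLeftOf.mono {A B A' B' : Set ℝ} (h : StrictLeftOf A B) (hA : A' ⊆ A) (hB : B' ⊆ B) :
    StrictLeftOf A' B' := fun x hx y hy => h x (hA hx) y (hB hy)

theorem subset_Ioo_of_notMem {A : Set ℝ} (hA : IsPreconnected A) {a b x : ℝ} (hx : x ∈ A)
    (hxab : x ∈ Ioo a b) (ha : a ∉ A) (hb : b ∉ A) : A ⊆ Ioo a b := by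
  intro y hy
  constructor
  · by_contra h
    exact ha (hA.Icc_subset hy hx ⟨not_lt.1 h, hxab.1.le⟩)
  · by_contra h
    exact hb (hA.Icc_subset hx hy ⟨hxab.2.le, not_lt.1 h⟩)

/-- The bands of `[c, m]` and of `[c, m + 1]` in a band of `c` interlace strictly. -/
theorem IsBand.exists_subbands (hV : 4 < V) (hl : ∀ d ∈ l, 1 ≤ d) {I : Set ℝ}
    (hI : IsBand (0 :: 0 :: l) V I) {T : BandType} (h : Over V l T I) {m : ℕ} (hm : 1 ≤ m) :
    ∃ (J : Fin (T.count m) → Set ℝ) (K : Fin (T.count m + 1) → Set ℝ),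
      (∀ i, IsBand (0 :: 0 :: (l ++ [(m : ℤ)])) V (J i)) ∧
      (∀ j, IsBand (0 :: 0 :: (l ++ [((m + 1 : ℕ) : ℤ)])) V (K j)) ∧
      (∀ i, StrictIncl (J i) I) ∧ (∀ j, StrictIncl (K j) I) ∧
      ∀ i : Fin (T.count m),
        StrictLeftOf (K i.castSucc) (J i) ∧ StrictLeftOf (J i) (K i.succ) := by
  obtain ⟨α, hα⟩ := exists_full hV hl
  obtain ⟨a, b, hab, rfl⟩ := hI.exists_crossing hV hl
  have hseq := traceSeq V hl T
  have hz : ∀ E ∈ Icc a b, |trD V l (((0 : ℕ) : ℤ) + T.digit) E| ≤ 2 := fun E hE => by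
    simpa using h E hE
  obtain ⟨P, Q, hP, hQ, hPQ, hP1, hQ1, -, -⟩ := hseq.exists_nodes hV hab hz (T.count m)
  have e2 : ((T.count m + 2 : ℕ) : ℤ) + T.digit = (m + 1 : ℕ) := by
    have := count_add_digit T hm
    push_cast at this ⊢
    linarith
  simp only [count_add_digit T hm] at hQ1
  simp only [e2] at hP1
  -- Successors are unstable at both ends of I, so a band through an interior node cannot reach an
  -- end.
  have hedge : ∀ k : ℕ, 1 ≤ k → ∀ x, |trF V l x| = 2 → ∀ A : Set ℝ,
      A ⊆ stable (trD V l k) → x ∉ A := fun k hk x hx A hA hxA =>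
    (hα.edge hV hl hx hk).not_ge (mem_stable.1 (hA hxA))
  have hJ := fun i => isBand_of_mem (c := 0 :: 0 :: (l ++ [(m : ℤ)])) (mem_stable.2 (hQ1 i))
  have hK := fun j => isBand_of_mem (c := 0 :: 0 :: (l ++ [((m + 1 : ℕ) : ℤ)]))
    (mem_stable.2 (hP1 j))
  have hQJ := fun i => mem_connectedComponentIn (mem_stable.2 (hQ1 i))
  have hPK := fun j => mem_connectedComponentIn (mem_stable.2 (hP1 j))
  have hJI := fun i => subset_Ioo_of_notMem (hJ i).isPreconnected (hQJ i) (hQ i)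
    (hedge m hm a hab.abs_left _ (hJ i).subset) (hedge m hm b hab.abs_right _ (hJ i).subset)
  have hKI := fun j => subset_Ioo_of_notMem (hK j).isPreconnected (hPK j) (hP j)
    (hedge (m + 1) (by lia) a hab.abs_left _ (hK j).subset)
    (hedge (m + 1) (by lia) b hab.abs_right _ (hK j).subset)
  -- On I, the traces of `[c, m]` and `[c, m + 1]` are not both in [-2, 2]. The order of the nodes
  -- then decides the order of the bands.
  have hdisj : ∀ i j, Disjoint (connectedComponentIn (stable (trD V l m)) (Q i))
      (connectedComponentIn (stable (trD V l (m + 1 : ℕ))) (P j)) := by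
    intro i j
    refine disjoint_left.2 fun E h1 h2 => ?_
    have hF := mem_stable.1 (hab.subset (Ioo_subset_Icc_self (hJI i h1)))
    have := hseq.excl hV (m := T.count m + 1) hF (by
      rw [count_add_digit T hm]; exact mem_stable.1 ((hJ i).subset h1))
    rw [e2] at this
    exact this.not_ge (mem_stable.1 ((hK j).subset h2))
  refine ⟨_, _, hJ, hK, fun i => ?_, fun j => ?_, fun i => ⟨?_, ?_⟩⟩
  · rw [StrictIncl, interior_Icc]; exact hJI i
  · rw [StrictIncl, interior_Icc]; exact hKI j
  · exact strictLeftOf_of_disjoint (hK _).isPreconnected (hJ _).isPreconnected (hdisj _ _).symm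
      (hPK _) (hQJ _) (hPQ i).1
  · exact strictLeftOf_of_disjoint (hJ _).isPreconnected (hK _).isPreconnected (hdisj _ _)
      (hQJ _) (hPK _) (hPQ i).2

/-- The matching of indices is a strictly increasing map of `Fin N` to itself, hence the identity.
-/
theorem eq_of_strictMono_of_exists {N : ℕ} {β : Type*} {J J' : Fin N → β} (φ : β → ℝ)
    (h : StrictMono fun i => φ (J i)) (h' : StrictMono fun i => φ (J' i))
    (hex : ∀ i, ∃ k, J k = J' i) : J' = J := by
  choose σ hσ using hex
  have hm : StrictMono σ := fun i j hij => by
    have := h' hij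
    simp only [← hσ] at this
    exact h.lt_iff_lt.1 this
  have hsurj : Function.Surjective σ := Finite.injective_iff_surjective.1 hm.injective
  have : σ = id := (hm.range_inj strictMono_id).1 (by
    rw [hsurj.range_eq, range_id])
  funext i
  rw [← hσ, this]; rfl

theorem strictMono_of_interlace {N : ℕ} {A : Fin N → ℝ} {B : Fin (N + 1) → ℝ}
    (h : ∀ i : Fin N, B i.castSucc < A i ∧ A i < B i.succ) : StrictMono A ∧ StrictMono B := by
  have hB : StrictMono B := Fin.strictMono_iff_lt_succ.2 fun i => (h i).1.trans (h i).2
  refine ⟨fun i j hij => ?_, hB⟩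
  have h2 : B i.succ ≤ B j.castSucc := hB.monotone (by
    rw [Fin.le_def]; simp; exact hij)
  exact (h i).2.trans_le (h2.trans (h j).1.le)

theorem append_pair (l : List ℤ) (m n : ℤ) :
    (0 :: 0 :: l) ++ [m, n] = 0 :: 0 :: (l ++ [m] ++ [n]) := by simp

theorem IsBand.not_weakBackward (hV : 4 < V) (hl : ∀ d ∈ l, 1 ≤ d) {I : Set ℝ}
    (hI : IsBand (0 :: 0 :: l) V I) {T T' : BandType} (h : Over V l T I) (hT : T ≠ T') :
    ¬ WeakBackward T' (0 :: 0 :: l) V I := by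
  intro hw
  obtain ⟨E, hE⟩ := hI.nonempty
  exact hT (h.unique hV hl hE hI.subset (hw.over E hE))

/-- A band of type `B` of `[c, n]` contains a unique band of `[c, n + 1]`. -/
theorem IsBand.exists_unique_next (hV : 4 < V) (hl : ∀ d ∈ l, 1 ≤ d) {n : ℕ} (hn : 1 ≤ n)
    {L : Set ℝ} (hL : IsBand (0 :: 0 :: (l ++ [(n : ℤ)])) V L) (h : Over V (l ++ [(n : ℤ)]) .B L) :
    ∃ L', IsBand (0 :: 0 :: (l ++ [((n + 1 : ℕ) : ℤ)])) V L' ∧ StrictIncl L' L ∧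
      ∀ L'', IsBand (0 :: 0 :: (l ++ [((n + 1 : ℕ) : ℤ)])) V L'' → L'' ⊆ L → L' = L'' := by
  have hn' : (1 : ℤ) ≤ n := by exact_mod_cast hn
  have hl' := append_pos hl hn'
  have heval : eval (0 :: 0 :: (l ++ [(n : ℤ)] ++ [((1 : ℕ) : ℤ)])) =
      eval (0 :: 0 :: (l ++ [((n + 1 : ℕ) : ℤ)])) := by
    rw [Nat.cast_one, eval_append_one hl hn']; norm_cast
  -- `[c, n + 1]` is `[c, n, 1]`, and a type B band has exactly one sub-band for the digit 1.
  obtain ⟨J, K, hJ, -, hJI, -, -⟩ := hL.exists_subbands hV hl' h le_rfl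
  refine ⟨J ⟨0, Nat.one_pos⟩, (isBand_congr heval _ _).1 (hJ _), hJI _, fun L'' h1 h2 => ?_⟩
  have hinj : Function.Injective J := fun i j _ => Subsingleton.elim (α := Fin 1) i j
  obtain ⟨i, hi⟩ := hL.exists_eq hV hl' h le_rfl rfl hJ (fun i => (hJI i).trans interior_subset)
    hinj ((isBand_congr heval _ _).2 h1) h2
  rw [← hi]
  congr 1
  exact Subsingleton.elim (α := Fin 1) _ _

/-- The type B predecessor of `[c, m, n]` is `[c, m, n - 1]`, so nesting in the chain propagates
type B. -/
theorem over_of_subset {m n : ℤ} {L : Set ℝ} (h : L ⊆ stable (trD V (l ++ [m]) (n - 1))) :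
    Over V (l ++ [m] ++ [n]) .B L := by
  intro E hE
  rw [BandType.digit, trD_append_neg_one]
  exact mem_stable.1 (h hE)

/-- The chain of bands `K n` in the definition of forward type. -/
theorem exists_chain (hV : 4 < V) (hl : ∀ d ∈ l, 1 ≤ d) {m : ℕ} (hm : 1 ≤ m) {I L : Set ℝ}
    (hI : IsBand (0 :: 0 :: l) V I)
    (hL : IsBand (0 :: 0 :: (l ++ [((m + 1 : ℕ) : ℤ)])) V L) (hLI : StrictIncl L I) :
    ∃ K : ℕ → Set ℝ, K 0 = I ∧ K 1 = L ∧
      (∀ n : ℕ, 1 ≤ n → IsBand (0 :: 0 :: (l ++ [(m : ℤ)] ++ [(n : ℤ)])) V (K n)) ∧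
      (∀ n : ℕ, 1 ≤ n → StrictIncl (K n) (K (n - 1))) ∧
      (∀ n : ℕ, 1 ≤ n → Over V (l ++ [(m : ℤ)] ++ [(n : ℤ)]) .B (K n)) ∧
      (∀ n : ℕ, 2 ≤ n → ∀ L', IsBand (0 :: 0 :: (l ++ [(m : ℤ)] ++ [(n : ℤ)])) V L' →
        L' ⊆ K (n - 1) → K n = L') := by
  have hm' : (1 : ℤ) ≤ m := by exact_mod_cast hm
  have hl' := append_pos hl hm'
  -- The index is shifted by one: the first component k belongs to the digit n = k + 1, since the
  -- chain of type B bands starts at n = 1.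
  let C := {p : ℕ × Set ℝ // IsBand (0 :: 0 :: (l ++ [(m : ℤ)] ++ [((p.1 + 1 : ℕ) : ℤ)])) V p.2 ∧
    Over V (l ++ [(m : ℤ)] ++ [((p.1 + 1 : ℕ) : ℤ)]) .B p.2}
  have hstep : ∀ p : C, ∃ p' : C, p'.1.1 = p.1.1 + 1 ∧ StrictIncl p'.1.2 p.1.2 ∧
      ∀ L', IsBand (0 :: 0 :: (l ++ [(m : ℤ)] ++ [((p.1.1 + 2 : ℕ) : ℤ)])) V L' →
        L' ⊆ p.1.2 → p'.1.2 = L' := by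
    rintro ⟨⟨n, S⟩, h1, h2⟩
    obtain ⟨S', h3, h4, h5⟩ := IsBand.exists_unique_next hV hl' (by simp) h1 h2
    refine ⟨⟨⟨n + 1, S'⟩, h3, over_of_subset ?_⟩, rfl, h4, h5⟩
    have : ((n + 1 + 1 : ℕ) : ℤ) - 1 = (n + 1 : ℕ) := by push_cast; ring
    rw [this]
    exact (h4.trans interior_subset).trans h1.subset
  choose s hs1 hs2 hs3 using hstep
  have heval : eval (0 :: 0 :: (l ++ [(m : ℤ)] ++ [((0 + 1 : ℕ) : ℤ)])) =
      eval (0 :: 0 :: (l ++ [((m + 1 : ℕ) : ℤ)])) := by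
    rw [zero_add, Nat.cast_one, eval_append_one hl hm']; norm_cast
  -- At n = 1 the type B predecessor is `[c, m, 0]`, which has the value of `c`, and L lies in I.
  have hover : Over V (l ++ [(m : ℤ)] ++ [((0 + 1 : ℕ) : ℤ)]) .B L := by
    refine over_of_subset ?_
    rw [zero_add, Nat.cast_one, sub_self, trD_append_zero]
    exact (hLI.trans interior_subset).trans hI.subset
  let p₀ : C := ⟨⟨0, L⟩, (isBand_congr heval _ _).2 hL, hover⟩
  let F : ℕ → C := fun n => s^[n] p₀
  have hF : ∀ n, F (n + 1) = s (F n) := fun n => Function.iterate_succ_apply' s n p₀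
  have hF1 : ∀ n, (F n).1.1 = n := by
    intro n
    induction n with
    | zero => rfl
    | succ n ih => rw [hF, hs1, ih]
  refine ⟨fun n => n.casesOn I fun k => (F k).1.2, rfl, rfl, fun n hn => ?_, fun n hn => ?_,
    fun n hn => ?_, fun n hn L' h1 h2 => ?_⟩
  · obtain ⟨k, rfl⟩ := Nat.exists_eq_add_of_le' hn
    have := (F k).2.1
    rw [hF1] at this
    exact this
  · obtain ⟨k, rfl⟩ := Nat.exists_eq_add_of_le' hn
    rcases k with _ | k
    · exact hLI
    · have := hs2 (F k)
      rw [← hF] at this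
      exact this
  · obtain ⟨k, rfl⟩ := Nat.exists_eq_add_of_le' hn
    have := (F k).2.2
    rw [hF1] at this
    exact this
  · obtain ⟨k, rfl⟩ := Nat.exists_eq_add_of_le' hn
    have := hs3 (F k) L'
    rw [hF1, ← hF] at this
    exact this h1 h2

/-- Existence, uniqueness, exhaustion and strict interlacing of the forward family. -/
theorem IsBand.forwardFamily (hV : 4 < V) (hl : ∀ d ∈ l, 1 ≤ d) {I : Set ℝ}
    (hI : IsBand (0 :: 0 :: l) V I) {T : BandType} (h : Over V l T I) {m : ℕ} (hm : 1 ≤ m) :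
    ∃ (J : Fin (T.count m) → Set ℝ) (K : ℕ → Fin (T.count m + 1) → Set ℝ),
      IsForwardFamily (0 :: 0 :: l) V I m (T.count m) J K ∧
      (∀ J' K', IsForwardFamily (0 :: 0 :: l) V I m (T.count m) J' K' → J' = J ∧ K' = K) ∧
      (∀ L : Set ℝ, IsBand (0 :: 0 :: l ++ [(m : ℤ)]) V L → L ⊆ I → ∃ i, J i = L) ∧
      (∀ n : ℕ, 1 ≤ n → ∀ L : Set ℝ, IsBand (0 :: 0 :: l ++ [(m : ℤ), (n : ℤ)]) V L →
        (∃ j, StrictIncl L (K (n - 1) j)) → ∃ j, K n j = L) ∧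
      (∀ n : ℕ, 1 ≤ n → ∀ i : Fin (T.count m),
        StrictLeftOf (K n i.castSucc) (J i) ∧ StrictLeftOf (J i) (K n i.succ)) := by
  have hm' : (1 : ℤ) ≤ m := by exact_mod_cast hm
  have hl' := append_pos hl hm'
  obtain ⟨J, K₁, hJ, hK₁, hJI, hKI, hint⟩ := hI.exists_subbands hV hl h hm
  choose K hK0 hK1 hKb hKs hKo hKu using fun j => exists_chain hV hl hm hI (hK₁ j) (hKI j)
  have hleft : ∀ {A B : Set ℝ} {l₁ l₂ : List ℤ}, (∀ d ∈ l₁, 1 ≤ d) → (∀ d ∈ l₂, 1 ≤ d) →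
      IsBand (0 :: 0 :: l₁) V A → IsBand (0 :: 0 :: l₂) V B → StrictLeftOf A B → LeftOf A B := by
    intro A B l₁ l₂ h₁ h₂ hA hB hAB
    obtain ⟨a, b, hab, rfl⟩ := hA.exists_crossing hV h₁
    obtain ⟨c, d, hcd, rfl⟩ := hB.exists_crossing hV h₂
    exact StrictLeftOf.leftOf hab.lt hcd.lt hAB
  have hl'' : ∀ n : ℕ, 1 ≤ n → ∀ d ∈ l ++ [(m : ℤ)] ++ [(n : ℤ)], 1 ≤ d := fun n hn =>
    append_pos hl' (by exact_mod_cast hn)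
  have hsub : ∀ j n, 1 ≤ n → K j n ⊆ K₁ j := by
    intro j n hn
    induction n, hn using Nat.le_induction with
    | base => rw [hK1]
    | succ n hn ih => exact ((hKs j (n + 1) (by lia)).trans interior_subset).trans ih
  have hstrict : ∀ n : ℕ, 1 ≤ n → ∀ i : Fin (T.count m),
      StrictLeftOf (K i.castSucc n) (J i) ∧ StrictLeftOf (J i) (K i.succ n) := fun n hn i =>
    ⟨(hint i).1.mono (hsub _ n hn) subset_rfl, (hint i).2.mono subset_rfl (hsub _ n hn)⟩
  have hfam : IsForwardFamily (0 :: 0 :: l) V I m (T.count m) J fun n j => K j n := by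
    refine ⟨hJ, hJI, fun i => ?_, hK0, fun n hn j => ?_, fun n hn j => hKs j n hn,
      fun n hn j => ?_, fun n hn i => ?_⟩
    · refine (hJ i).not_weakBackward hV hl' (T := .A) ?_ (by simp)
      intro E hE
      rw [BandType.digit, trD_append_zero]
      exact mem_stable.1 (hI.subset (interior_subset (hJI i hE)))
    · rw [append_pair]; exact hKb j n hn
    · rw [append_pair]
      exact (hKb j n hn).not_weakBackward hV (hl'' n hn) (hKo j n hn) (by simp)
    · exact ⟨hleft (hl'' n hn) hl' (hKb _ n hn) (hJ i) (hstrict n hn i).1,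
        hleft hl' (hl'' n hn) (hJ i) (hKb _ n hn) (hstrict n hn i).2⟩
  -- Interlacing at n = 1 already sorts both families by left endpoints.
  have hmono : ∀ {J' : Fin (T.count m) → Set ℝ} {K' : ℕ → Fin (T.count m + 1) → Set ℝ},
      IsForwardFamily (0 :: 0 :: l) V I m (T.count m) J' K' →
      StrictMono (fun i => sInf (J' i)) ∧ StrictMono fun j => sInf (K' 1 j) := fun hf =>
    strictMono_of_interlace fun i =>
      ⟨(hf.interlace 1 le_rfl i).1.1, (hf.interlace 1 le_rfl i).2.1⟩
  have hinjJ : Function.Injective J := fun i j hij =>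
    (hmono hfam).1.injective (by simp only [hij])
  have hinjK : Function.Injective K₁ := fun i j hij =>
    (hmono hfam).2.injective (by simp only [hK1, hij])
  have hallJ : ∀ L : Set ℝ, IsBand (0 :: 0 :: l ++ [(m : ℤ)]) V L → L ⊆ I → ∃ i, J i = L :=
    fun L hL hLI => hI.exists_eq hV hl h hm rfl hJ
      (fun i => (hJI i).trans interior_subset) hinjJ hL hLI
  have heval : eval (0 :: 0 :: l ++ [(m : ℤ), ((1 : ℕ) : ℤ)]) =
      eval (0 :: 0 :: (l ++ [((m + 1 : ℕ) : ℤ)])) := by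
    rw [append_pair, Nat.cast_one, eval_append_one hl hm']; norm_cast
  have hcount : T.count m + 1 = T.count (m + 1) := by
    cases T <;> simp [BandType.count]; lia
  -- At n = 1 every parent is I itself, and the M + 1 bands are all those of `[c, m + 1]` in I, so
  -- the index is not determined by the parent. From n = 2 on, each parent has one child and the
  -- index is preserved.
  have hallK : ∀ n : ℕ, 1 ≤ n → ∀ L : Set ℝ, IsBand (0 :: 0 :: l ++ [(m : ℤ), (n : ℤ)]) V L →
      ∀ j, L ⊆ K j (n - 1) → ∃ j', K j' n = L ∧ (2 ≤ n → j' = j) := by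
    intro n hn L hL j hLj
    rcases hn.eq_or_lt with rfl | hn2
    · obtain ⟨j', hj'⟩ := hI.exists_eq hV hl h (m := m + 1) (by lia) hcount hK₁
        (fun j => (hKI j).trans interior_subset) hinjK ((isBand_congr heval _ _).1 hL)
        (hK0 j ▸ hLj)
      exact ⟨j', (hK1 j').trans hj', fun h => by lia⟩
    · rw [append_pair] at hL
      exact ⟨j, hKu j n hn2 L hL hLj, fun _ => rfl⟩
  refine ⟨J, fun n j => K j n, hfam, fun J' K' hf => ⟨?_, ?_⟩, hallJ, ?_, hstrict⟩
  · exact eq_of_strictMono_of_exists sInf (hmono hfam).1 (hmono hf).1 fun i =>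
      hallJ _ (hf.bandA i) ((hf.strictA i).trans interior_subset)
  · funext n
    induction n with
    | zero =>
      funext j
      rw [hf.zero, hK0]
    | succ n ih =>
      have hex : ∀ j, ∃ j', K j' (n + 1) = K' (n + 1) j ∧ (2 ≤ n + 1 → j' = j) := fun j => by
        refine hallK (n + 1) (by lia) _ (hf.bandB (n + 1) (by lia) j) j ?_
        have := (hf.strictB (n + 1) (by lia) j).trans interior_subset
        rw [Nat.add_sub_cancel, ih] at this
        exact this
      -- Level 1 is identified by sorted order, every later level by its parent.
      rcases Nat.eq_zero_or_pos n with rfl | hn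
      · exact eq_of_strictMono_of_exists sInf (hmono hfam).2 (hmono hf).2 fun j =>
          (hex j).imp fun _ => And.left
      · funext j
        obtain ⟨j', h1, h2⟩ := hex j
        rw [← h1, h2 (by lia)]
  · rintro n hn L hL ⟨j, hj⟩
    obtain ⟨j', h1, -⟩ := hallK n hn L hL j (hj.trans interior_subset)
    exact ⟨j', h1⟩

theorem Over.hasType (hV : 4 < V) (hl : ∀ d ∈ l, 1 ≤ d) {I : Set ℝ}
    (hI : IsBand (0 :: 0 :: l) V I) {T : BandType} (h : Over V l T I) :
    HasType T (0 :: 0 :: l) V I := by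
  refine ⟨h.backward hV hl hI, fun m hm => ?_⟩
  obtain ⟨J, K, hJK, -⟩ := hI.forwardFamily hV hl h hm
  exact ⟨J, K, hJK⟩

end Subbands

/-! ### Independence of the type from V -/

section Independence

open Set Topology Filter

variable {l : List ℤ}

theorem BandSystem.mem_range {f : ℝ → ℝ} {q : ℕ} {e a b : Fin q → ℝ} (h : BandSystem f q e a b)
    {E : ℝ} (hE : f E = 0) : ∃ i, e i = E := by
  obtain ⟨i, hi⟩ := h.cover E (mem_stable.2 (by rw [hE]; norm_num))
  exact ⟨i, (h.crossing i).injOn (Ioo_subset_Icc_self (h.mem i)) hi ((h.zero i).trans hE.symm)⟩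

/-- Points near a zero in a band where the function has opposite signs. -/
theorem Crossing.exists_sign_change {f : ℝ → ℝ} {a b x ε : ℝ} (h : Crossing f a b)
    (hx : x ∈ Ioo a b) (h0 : f x = 0) (hε : 0 < ε) :
    ∃ s t, a ≤ s ∧ t ≤ b ∧ x - ε < s ∧ s < t ∧ t < x + ε ∧ f s * f t < 0 := by
  obtain ⟨s, hs1, hs2⟩ := exists_between (max_lt hx.1 (by linarith : x - ε < x))
  obtain ⟨t, ht1, ht2⟩ := exists_between (lt_min hx.2 (by linarith : x < x + ε))
  rw [max_lt_iff] at hs1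
  rw [lt_min_iff] at ht2
  have hs : s ∈ Icc a b := ⟨hs1.1.le, by linarith [hx.2]⟩
  have ht : t ∈ Icc a b := ⟨by linarith [hx.1], ht2.1.le⟩
  have hx' := Ioo_subset_Icc_self hx
  refine ⟨s, t, hs1.1.le, ht2.1.le, hs1.2, hs2.trans ht1, ht2.2, ?_⟩
  rcases h.mono with ⟨hm, -⟩ | ⟨hm, -⟩
  · exact mul_neg_of_neg_of_pos (h0 ▸ hm hs hx' hs2) (h0 ▸ hm hx' ht ht1)
  · exact mul_neg_of_pos_of_neg (h0 ▸ hm hs hx' hs2) (h0 ▸ hm hx' ht ht1)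

/-- The sorted zeros of the discriminant depend continuously on the coupling constant. -/
theorem continuousOn_zeros {e : ℝ → Fin (per l) → ℝ}
    (he : ∀ V, 4 < V → ∃ a b, BandSystem (trF V l) (per l) (e V) a b) (i : Fin (per l)) :
    ContinuousOn (fun V => e V i) (Ioi 4) := by
  intro V₀ hV₀
  rw [ContinuousWithinAt, Metric.tendsto_nhds]
  intro ε hε
  obtain ⟨a, b, hb⟩ := he V₀ hV₀
  -- Each zero at V₀ is bracketed by a sign change within ε and inside its own band; the finitely
  -- many sign changes persist for V near V₀.
  choose s t has htb hs hst ht hsign using fun i =>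
    (hb.crossing i).exists_sign_change (hb.mem i) (hb.zero i) hε
  have hcont : ∀ E, Continuous fun V => trF V l E := fun E =>
    (continuous_discr _).comp (continuous_const.prodMk continuous_id)
  have hev : ∀ᶠ V in 𝓝[Ioi 4] V₀, ∀ i, trF V l (s i) * trF V l (t i) < 0 := by
    refine eventually_all.2 fun i => nhdsWithin_le_nhds ?_
    exact ((hcont _).mul (hcont _)).continuousAt.eventually_lt_const (hsign i)
  filter_upwards [hev, self_mem_nhdsWithin] with V hV hV4
  have hex : ∀ i, ∃ x ∈ Icc (s i) (t i), trF V l x = 0 := by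
    intro i
    have hc : ContinuousOn (trF V l) (Icc (s i) (t i)) := (continuous_trF V l).continuousOn
    rcases mul_neg_iff.1 (hV i) with h | h
    · exact intermediate_value_Icc' (hst i).le hc ⟨h.2.le, h.1.le⟩
    · exact intermediate_value_Icc (hst i).le hc ⟨h.1.le, h.2.le⟩
  choose x hx hx0 using hex
  obtain ⟨a', b', hb'⟩ := he V hV4
  have hxm : StrictMono x := fun i j hij =>
    ((hx i).2.trans (htb i)).trans_lt ((hb.lt i j hij).trans_le ((has j).trans (hx j).1))
  -- The ordered brackets give as many sorted zeros as the trace has, so the i-th bracket holds the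
  -- i-th zero.
  have heq : x = e V := eq_of_strictMono_of_exists id hb'.strictMono hxm fun i =>
    hb'.mem_range (hx0 i)
  rw [← heq, Real.dist_eq, abs_lt]
  constructor <;> linarith [(hx i).1, (hx i).2, hs i, ht i]

/-- The type of the `i`-th band does not depend on the coupling constant. -/
theorem exists_type_of_zeros (hl : ∀ d ∈ l, 1 ≤ d) {e : ℝ → Fin (per l) → ℝ}
    (he : ∀ V, 4 < V → ∃ a b, BandSystem (trF V l) (per l) (e V) a b) (i : Fin (per l)) :
    ∃ T : BandType, ∀ V, 4 < V → |trD V l T.digit (e V i)| ≤ 2 := by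
  -- This graph of the i-th zero over V > 4 is connected, so it lies wholly in one of the two closed
  -- type sets, which are disjoint along it.
  let S : Set (ℝ × ℝ) := (fun V => (e V i, V)) '' Ioi 4
  have hSc : IsPreconnected S :=
    isPreconnected_Ioi.image _ ((continuousOn_zeros he i).prodMk continuousOn_id)
  have hzero : ∀ V, 4 < V → |trF V l (e V i)| ≤ 2 := fun V hV => by
    obtain ⟨a, b, hb⟩ := he V hV
    rw [hb.zero]; norm_num
  have hc : ∀ k : ℤ, IsClosed {p : ℝ × ℝ | |trD p.2 l k p.1| ≤ 2} := fun k =>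
    isClosed_le (continuous_discr _).abs continuous_const
  have := isPreconnected_iff_subset_of_disjoint_closed.1 hSc _ _ (hc 0) (hc (-1)) (by
      rintro _ ⟨V, hV, rfl⟩
      obtain ⟨α, hα⟩ := exists_full (V := V) hV hl
      exact (hα.cover _ (hzero V hV)).imp id id)
    (eq_empty_of_forall_notMem (by
      rintro _ ⟨⟨V, hV, rfl⟩, h1, h2⟩
      exact not_both hV hl (hzero V hV) h1 h2))
  have hmem : ∀ V, 4 < V → (e V i, V) ∈ S := fun V hV => ⟨V, hV, rfl⟩
  have hU : ∀ (k : ℤ) (V : ℝ), (e V i, V) ∈ {p : ℝ × ℝ | |trD p.2 l k p.1| ≤ 2} ↔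
      |trD V l k (e V i)| ≤ 2 := fun k V => by rw [mem_ofPred_eq]
  rcases this with h | h
  · refine ⟨.A, fun V hV => ?_⟩
    exact (hU 0 V).1 (h (hmem V hV))
  · refine ⟨.B, fun V hV => ?_⟩
    exact (hU (-1) V).1 (h (hmem V hV))

theorem exists_types (hl : ∀ d ∈ l, 1 ≤ d) :
    ∃ τ : Fin (per l) → BandType, ∀ V : ℝ, 4 < V → ∃ I : Fin (per l) → Set ℝ,
      (∀ i j, i < j → StrictLeftOf (I i) (I j)) ∧
      (∀ L : Set ℝ, IsBand (0 :: 0 :: l) V L ↔ ∃ i, I i = L) ∧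
      ∀ i, HasType (τ i) (0 :: 0 :: l) V (I i) := by
  have hex : ∀ V : ℝ, ∃ e : Fin (per l) → ℝ, 4 < V →
      ∃ a b, BandSystem (trF V l) (per l) e a b := by
    intro V
    by_cases hV : 4 < V
    · obtain ⟨α, hα⟩ := exists_full hV hl
      obtain ⟨e, a, b, hb⟩ := hα.hyp.exists_bandSystem
      exact ⟨e, fun _ => ⟨a, b, hb⟩⟩
    · exact ⟨0, fun h => absurd h hV⟩
  choose e he using hex
  choose τ hτ using exists_type_of_zeros hl he
  refine ⟨τ, fun V hV => ?_⟩
  obtain ⟨a, b, hb⟩ := he V hV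
  have hmem := fun i => Ioo_subset_Icc_self (hb.mem i)
  have hband : ∀ i, IsBand (0 :: 0 :: l) V (Icc (a i) (b i)) := fun i =>
    ⟨e V i, (hb.crossing i).subset (hmem i), (hb.comp i _ (hmem i)).symm⟩
  refine ⟨fun i => Icc (a i) (b i), fun i j hij x hx y hy => ?_, fun L => ⟨fun hL => ?_, ?_⟩,
    fun i => ?_⟩
  · exact hx.2.trans_lt ((hb.lt i j hij).trans_le hy.1)
  · obtain ⟨E, hE⟩ := hL.nonempty
    obtain ⟨i, hi⟩ := hb.cover E (hL.subset hE)
    exact ⟨i, (hband i).eq_of_mem hL hi hE⟩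
  · rintro ⟨i, rfl⟩
    exact hband i
  · obtain ⟨T, hT⟩ := (hband i).exists_over hV hl
    have : T = τ i := hT.unique hV hl (hmem i) (hband i).subset (hτ i V hV)
    exact this ▸ hT.hasType hV hl (hband i)

/-- Once another digit may follow, no digit of `c` after the two zeros can be 0 or -1, and `[0]` is
ruled out because `[0, 1]` is not an expansion. -/
theorem exists_digits {c : List ℤ} (hcm : c ++ [1] ∈ FinCF) :
    ∃ l : List ℤ, (∀ d ∈ l, 1 ≤ d) ∧ c = 0 :: 0 :: l := by
  rcases hcm with h | h | ⟨l, x, hl, -, h⟩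
  · have := congrArg List.getLast? h
    simp at this
  · have := congrArg List.getLast? h
    simp at this
  · have h' : c ++ [1] = (0 :: 0 :: l) ++ [x] := h
    exact ⟨l, hl, (List.append_inj' h' rfl).1⟩

end Independence

end Sturmian

open Sturmian in
theorem mainTheorem2 (c : List ℤ) (hc : c ∈ FinCF)
    (hcm : ∀ m : ℕ, 1 ≤ m → c ++ [(m : ℤ)] ∈ FinCF) :
    -- every spectral band has exactly one of the two types
    (∀ V : ℝ, 4 < V → ∀ I : Set ℝ, IsBand c V I → Xor (HasType .A c V I) (HasType .B c V I)) ∧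
    -- the type of the `i`-th of the `q` bands, counted from the left, does not depend on `V`
    (∃ τ : Fin (den (eval c)) → BandType, ∀ V : ℝ, 4 < V →
      ∃ I : Fin (den (eval c)) → Set ℝ,
        (∀ i j, i < j → StrictLeftOf (I i) (I j)) ∧
        (∀ L : Set ℝ, IsBand c V L ↔ ∃ i, I i = L) ∧
        ∀ i, HasType (τ i) c V (I i)) ∧
    -- the sub-bands are unique and strictly interlace
    (∀ V : ℝ, 4 < V → ∀ I : Set ℝ, IsBand c V I → ∀ T : BandType, HasType T c V I →
      ∀ m : ℕ, 1 ≤ m →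
        (∃! p : (Fin (T.count m) → Set ℝ) × (ℕ → Fin (T.count m + 1) → Set ℝ),
          IsForwardFamily c V I m (T.count m) p.1 p.2) ∧
        ∀ (J : Fin (T.count m) → Set ℝ) (K : ℕ → Fin (T.count m + 1) → Set ℝ),
          IsForwardFamily c V I m (T.count m) J K →
          (∀ L : Set ℝ, IsBand (c ++ [(m : ℤ)]) V L → L ⊆ I → ∃ i, J i = L) ∧
          (∀ n : ℕ, 1 ≤ n → ∀ L : Set ℝ, IsBand (c ++ [(m : ℤ), (n : ℤ)]) V L →
            (∃ j, StrictIncl L (K (n - 1) j)) →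
            ¬ WeakBackward .A (c ++ [(m : ℤ), (n : ℤ)]) V L → ∃ j, K n j = L) ∧
          (∀ n : ℕ, 1 ≤ n → ∀ i : Fin (T.count m),
            StrictLeftOf (K n i.castSucc) (J i) ∧ StrictLeftOf (J i) (K n i.succ))) := by
  obtain ⟨l, hl, rfl⟩ := exists_digits (hcm 1 le_rfl)
  refine ⟨fun V hV I hI => ?_, exists_types hl, fun V hV I hI T hT m hm => ?_⟩
  · obtain ⟨E, hE⟩ := hI.nonempty
    obtain ⟨T, hT⟩ := hI.exists_over hV hl
    have hunique : ∀ T', HasType T' (0 :: 0 :: l) V I → T = T' := fun T' h =>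
      hT.unique hV hl hE hI.subset (h.1.over E hE)
    have htype := hT.hasType hV hl hI
    cases T
    · exact Or.inl ⟨htype, fun h => by simpa using hunique _ h⟩
    · exact Or.inr ⟨htype, fun h => by simpa using hunique _ h⟩
  · obtain ⟨J, K, hJK, huniq, h1, h2, h3⟩ := hI.forwardFamily hV hl hT.1.over hm
    refine ⟨⟨(J, K), hJK, fun p hp => ?_⟩, fun J' K' hf => ?_⟩
    · obtain ⟨e1, e2⟩ := huniq _ _ hp
      exact Prod.ext e1 e2
    · obtain ⟨rfl, rfl⟩ := huniq _ _ hf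
      exact ⟨h1, fun n hn L hL hj _ => h2 n hn L hL hj, h3⟩
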